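/- Let $E: y^2=x^3+Ax+B$ with $A,B\in\mathbb{Z}$ and discriminant $\Delta(E)=-16(4A^3+27B^2)\neq 0$ be quasi-minimal, i.e. $|\Delta(E)|\le|\Delta(E')|$ for every $E': y^2=x^3+A'x+B'$ with $A',B'\in\mathbb{Z}$ that is isomorphic to $E$ over $\mathbb{Q}$. For a rational number $p/q$ in lowest terms put $h(p/q)=\log\max\{|p|,|q|\}$, and define $$h(E)=\max\{h(j(E)),\ \log\max\{4|A|,4|B|\}\},\qquad j(E)=\frac{1728\cdot 4A^3}{4A^3+27B^2}.$$ For $P\in E(\mathbb{Q})$ of infinite order let $\hat h(P)=\frac12\lim_{k\to\infty}4^{-k}h(x_{2^kP})$ be the canonical height (the limit exists). For each prime $p$ let $E_0(\mathbb{Q}_p)\subseteq E(\mathbb{Q}_p)$ be the finite-index subgroup of points whose reduction on a minimal Weierstrass equation of $E$ over $\mathbb{Q}_p$ is nonsingular, let $r(P,p)$ be the order of $P$ in $E(\mathbb{Q}_p)/E_0(\mathbb{Q}_p)$, and let $M=M(P)=\operatorname{lcm}_p r(P,p)$ over all primes $p$ (almost all $r(P,p)$ equal $1$). If $P\in E(\mathbb{Q})$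 has infinite order and $nP$ is integral (an affine point with integer coordinates) for some integer $n\ge 2$, then $$\hat h(P)\le \log n+\left(\tfrac{16}{3}M^2+2\right)h(E).$$ -/

import Mathlib

open WeierstrassCurve Filter Topology

noncomputable section

namespace QuasiMinimal

/-- The short Weierstrass equation `y² = x³ + A x + B` with integral coefficients. -/
def shortCurve (A B : ℤ) : WeierstrassCurve ℤ := ⟨0, 0, 0, A, B⟩

/-- The group `E(ℚ)`. -/
abbrev RatPoint (A B : ℤ) : Type := ((shortCurve A B)⁄ℚ).toAffine.Point

/-- The group `E(ℚ_p)`. -/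
abbrev PadicPoint (A B : ℤ) (p : ℕ) [Fact p.Prime] : Type :=
  ((shortCurve A B)⁄ℚ_[p]).toAffine.Point

/-- `E` is quasi-minimal: `|Δ(E)|` is minimal among all integral short Weierstrass equations
whose curve is isomorphic to `E` over `ℚ`. -/
def IsQuasiMinimal (A B : ℤ) : Prop :=
  ∀ A' B' : ℤ,
    (∃ C : VariableChange ℚ, C • ((shortCurve A B)⁄ℚ) = (shortCurve A' B')⁄ℚ) →
      |(shortCurve A B).Δ| ≤ |(shortCurve A' B').Δ|

/-- `j(E) = 1728 · 4A³ / (4A³ + 27B²)`. -/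
def jInvariant (A B : ℤ) : ℚ := 1728 * (4 * (A : ℚ) ^ 3) / (4 * (A : ℚ) ^ 3 + 27 * (B : ℚ) ^ 2)

/-- `h(E) = max {h(j(E)), log max {4|A|, 4|B|}}`, where for a rational number `p/q` in lowest
terms `h(p/q) = log max {|p|, |q|}` (`Rat.logHeight₁_eq_log_max`). -/
def curveHeight (A B : ℤ) : ℝ :=
  max (Height.logHeight₁ (jInvariant A B)) (Real.log (max (4 * |(A : ℝ)|) (4 * |(B : ℝ)|)))

/-- The logarithmic height of the `x`-coordinate of a rational point (`0` at infinity). -/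
def xHeight {A B : ℤ} : RatPoint A B → ℝ
  | .zero => 0
  | .some x _ _ => Height.logHeight₁ x

/-- The sequence `(1/2) h(x(2^k P)) / 4^k` whose limit is the canonical height of `P`. -/
def canonicalHeightSeq {A B : ℤ} (P : RatPoint A B) (k : ℕ) : ℝ :=
  1 / 2 * (xHeight ((2 ^ k : ℕ) • P) / 4 ^ k)

/-- The canonical height `ĥ(P) = (1/2) lim h(x(2^k P)) / 4^k`. -/
def canonicalHeight {A B : ℤ} (P : RatPoint A B) : ℝ :=
  limUnder atTop (canonicalHeightSeq P)

/-- A rational point is integral if it is an affine point with integer coordinates. -/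
def IsIntegralPoint {A B : ℤ} : RatPoint A B → Prop
  | .zero => False
  | .some x y _ => ∃ a b : ℤ, x = a ∧ y = b

section Local

instance instDecidableEqPadic (p : ℕ) [Fact p.Prime] : DecidableEq ℚ_[p] := Classical.decEq _

variable (p : ℕ) [Fact p.Prime]

/-- The affine point `(x, y)` of a minimal Weierstrass equation `W` over `ℚ_p` has nonsingular
reduction modulo `p`: either it reduces to the point at infinity, or it has `p`-integral
coordinates which reduce to a nonsingular point of the reduced curve. -/
def NonsingularReduction (W : WeierstrassCurve ℚ_[p]) [IsMinimal ℤ_[p] W] (x y : ℚ_[p]) : Prop :=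
  1 < ‖x‖ ∨ ∃ a b : ℤ_[p], x = a ∧ y = b ∧
    (W.reduction ℤ_[p]).toAffine.Nonsingular
      (IsLocalRing.residue ℤ_[p] a) (IsLocalRing.residue ℤ_[p] b)

/-- `P ∈ W(ℚ_p)` has nonsingular reduction on a minimal Weierstrass equation `C • W` of the curve.
The point `(x, y)` of `W` is the point `(x', y')` of `C • W` with
`x = u² x' + r` and `y = u³ y' + u² s x' + t`. -/
def HasNonsingularReduction (W : WeierstrassCurve ℚ_[p]) : W.toAffine.Point → Prop
  | .zero => True
  | .some x y _ => ∃ (C : VariableChange ℚ_[p]) (_ : IsMinimal ℤ_[p] (C • W)) (x' y' : ℚ_[p]),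
      x = (C.u : ℚ_[p]) ^ 2 * x' + C.r ∧
      y = (C.u : ℚ_[p]) ^ 3 * y' + (C.u : ℚ_[p]) ^ 2 * C.s * x' + C.t ∧
      NonsingularReduction p (C • W) x' y'

/-- The subgroup `W₀(ℚ_p)` of the points with nonsingular reduction on a minimal Weierstrass
equation. For an elliptic curve these points already form a subgroup; taking the subgroup that they
generate only serves to obtain an `AddSubgroup`. -/
def nonsingularSubgroup (W : WeierstrassCurve ℚ_[p]) : AddSubgroup W.toAffine.Point :=
  AddSubgroup.closure {P | HasNonsingularReduction p W P}

/-- The inclusion `E(ℚ) → E(ℚ_p)`. -/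
def toPadic {A B : ℤ} : RatPoint A B →+ PadicPoint A B p :=
  Affine.Point.map (W' := (shortCurve A B).toAffine) (Algebra.ofId ℚ ℚ_[p])

/-- `r(P, p)`: the order of `P` in the quotient `E(ℚ_p) / E₀(ℚ_p)`. -/
def componentOrder {A B : ℤ} (P : RatPoint A B) : ℕ :=
  addOrderOf (QuotientAddGroup.mk (toPadic p P) :
    PadicPoint A B p ⧸ nonsingularSubgroup p ((shortCurve A B)⁄ℚ_[p]))

end Local

/-- `M(P) = lcm {r(P, p)}` over all primes `p`: the least positive common multiple (the numbers
`r(P, p)` are positive, and equal to `1` for all but finitely many `p`). -/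
def componentLcm {A B : ℤ} (P : RatPoint A B) : ℕ :=
  sInf {m : ℕ | 0 < m ∧ ∀ (p : ℕ) [Fact p.Prime], componentOrder p P ∣ m}

end QuasiMinimal

end

/-!
The local term `16 / 3 * M² * h(E)` is nonnegative, and the proof gives the stronger bound
`ĥ(P) ≤ log n + 2 H` with `H = log max {4|A|, 4|B|} ≤ h(E)` (`canonicalHeight_le_log_add`).

An integral multiple `nP` of a point `P` of infinite order forces `x(P)` to be an integer: if a prime
divided the denominator of `x(P)`, then `P`, hence every multiple of `P`, would reduce to the point
at infinity (`exists_int_x_of_nsmul`). So `h(x(P)) = log |x(P)|`, and there are two cases.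

* If `x(P) ≤ 4 n² e^(2H)`, the claim follows from `ĥ(P) ≤ h(x(P)) / 2 + H / 3`, a consequence of
  `h(x(2P)) ≤ 4 h(x(P)) + 2 H` (`canonicalHeight_bounds`).
* If `x(P)` is larger, then `P` is so close to the point at infinity in the real topology that its
  multiples up to `nP` do not wind around the real locus. Hence `x(nP)` is at most `4 x(P)`
  (`x_nsmul_le_of_large_x`), so `ĥ(nP)` exceeds `ĥ(P)` by at most a multiple of `H`. But
  `ĥ(nP) = n² ĥ(P)` (`canonicalHeight_nsmul`), so `ĥ(P)` itself is at most a multiple of `H`.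

Both the `p`-adic and the real statement about points near infinity come from one formula for the
group law in the coordinates `z = x / y`, `w = 1 / y`, in which `z(P + Q) - z(P) - z(Q)` is of
higher order (`chord_at_infinity`). The quadraticity of `ĥ` rests on the approximate parallelogram
law `exists_abs_xHeight_parallelogram_le`, and the explicit comparison with `h` on the resultant
identities for the duplication map (`duplication_forms`).
-/

namespace QuasiMinimal


/-! ### The group law near the point at infinity -/

section Chord

variable {A B : ℤ}

lemma shortCurve_a₁ : ((shortCurve A B)⁄ℚ).a₁ = 0 := by simp [shortCurve]
lemma shortCurve_a₂ : ((shortCurve A B)⁄ℚ).a₂ = 0 := by simp [shortCurve]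
lemma shortCurve_a₃ : ((shortCurve A B)⁄ℚ).a₃ = 0 := by simp [shortCurve]
lemma shortCurve_a₄ : ((shortCurve A B)⁄ℚ).a₄ = A := by simp [shortCurve]
lemma shortCurve_a₆ : ((shortCurve A B)⁄ℚ).a₆ = B := by simp [shortCurve]

lemma shortCurve_equation {x y : ℚ} :
    ((shortCurve A B)⁄ℚ).toAffine.Equation x y ↔ y ^ 2 = x ^ 3 + A * x + B := by
  simp [Affine.equation_iff, shortCurve]

lemma shortCurve_negY (x y : ℚ) : ((shortCurve A B)⁄ℚ).toAffine.negY x y = -y := by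
  simp [Affine.negY, shortCurve]

/-- The sum of two points that are not opposite to each other, described by the line
`y = ℓ x + m` through them (their tangent if they coincide) and the Vieta relations for the three
points in which it meets the curve. -/
lemma exists_add_some {x₁ y₁ x₂ y₂ : ℚ}
    (h₁ : ((shortCurve A B)⁄ℚ).toAffine.Nonsingular x₁ y₁)
    (h₂ : ((shortCurve A B)⁄ℚ).toAffine.Nonsingular x₂ y₂) (h : ¬(x₁ = x₂ ∧ y₁ = -y₂)) :
    ∃ (ℓ m x₃ y₃ : ℚ) (h₃ : ((shortCurve A B)⁄ℚ).toAffine.Nonsingular x₃ y₃),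
      (Affine.Point.some x₁ y₁ h₁ + Affine.Point.some x₂ y₂ h₂ : RatPoint A B) =
        Affine.Point.some x₃ y₃ h₃ ∧
      y₁ = ℓ * x₁ + m ∧ y₂ = ℓ * x₂ + m ∧ -y₃ = ℓ * x₃ + m ∧
      x₁ + x₂ + x₃ = ℓ ^ 2 ∧ x₁ * x₂ + x₁ * x₃ + x₂ * x₃ = A - 2 * ℓ * m ∧
      x₁ * x₂ * x₃ = m ^ 2 - B ∧ (x₁ = x₂ → y₁ = y₂ ∧ 2 * y₁ * ℓ = 3 * x₁ ^ 2 + A) := by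
  have h' : ¬(x₁ = x₂ ∧ y₁ = ((shortCurve A B)⁄ℚ).toAffine.negY x₂ y₂) := by
    rwa [shortCurve_negY]
  have key := Affine.addPolynomial_slope h₁.left h₂.left h'
  have hs : x₁ = x₂ → y₁ = y₂ ∧
      2 * y₁ * ((shortCurve A B)⁄ℚ).toAffine.slope x₁ x₂ y₁ y₂ = 3 * x₁ ^ 2 + A := by
    intro hx
    have hy : y₁ ≠ ((shortCurve A B)⁄ℚ).toAffine.negY x₂ y₂ := fun e ↦ h' ⟨hx, e⟩
    have hyy := Affine.Y_eq_of_Y_ne h₁.left h₂.left hx hy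
    refine ⟨hyy, ?_⟩
    rw [Affine.slope_of_Y_ne hx hy, shortCurve_negY]
    rw [shortCurve_negY, ← hyy] at hy
    have : y₁ ≠ 0 := by rintro rfl; simp at hy
    have : y₁ - -y₁ ≠ 0 := by rw [sub_neg_eq_add, ← two_mul]; simpa
    simp only [shortCurve_a₁, shortCurve_a₂, shortCurve_a₄]
    field_simp
    ring
  have hy₂ : y₂ = ((shortCurve A B)⁄ℚ).toAffine.slope x₁ x₂ y₁ y₂ * (x₂ - x₁) + y₁ := by
    by_cases hx : x₁ = x₂
    · simp [← hx, (hs hx).1]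
    · rw [Affine.slope_of_X_ne hx]
      have := sub_ne_zero.2 hx
      field_simp
      ring
  rw [Affine.addPolynomial_eq, neg_inj, Cubic.prod_X_sub_C_eq, Cubic.toPoly_injective] at key
  refine ⟨((shortCurve A B)⁄ℚ).toAffine.slope x₁ x₂ y₁ y₂,
    y₁ - ((shortCurve A B)⁄ℚ).toAffine.slope x₁ x₂ y₁ y₂ * x₁, _, _, _,
    Affine.Point.add_some h', ?_, ?_, ?_, ?_, ?_, ?_, hs⟩
  · ring
  · linear_combination hy₂
  · rw [Affine.addY, shortCurve_negY, Affine.negAddY]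
    ring
  · rw [Affine.addX, shortCurve_a₁, shortCurve_a₂]
    ring
  · have := congrArg Cubic.c key
    simp only [shortCurve_a₁, shortCurve_a₃, shortCurve_a₄] at this
    linear_combination -this
  · have := congrArg Cubic.d key
    simp only [shortCurve_a₃, shortCurve_a₆] at this
    linear_combination this

/-- The group law in the coordinates `z = x / y` and `w = 1 / y`, in which the curve is
`w = z³ + A z w² + B w³` and the point at infinity is the origin. The line through the two given
points is `w = lam z + nu`, where `lam` is the difference quotient of `w` with the factor `z₁ - z₂`
cancelled, so that the formulas also hold for the tangent. -/
lemma chord_at_infinity {K : Type*} [Field K] [CharZero K]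
    {A B x₁ y₁ x₂ y₂ x₃ y₃ ℓ m lam nu : K} (hy₁ : y₁ ≠ 0) (hy₂ : y₂ ≠ 0)
    (l₁ : y₁ = ℓ * x₁ + m) (l₂ : y₂ = ℓ * x₂ + m) (l₃ : -y₃ = ℓ * x₃ + m)
    (e₁ : x₁ + x₂ + x₃ = ℓ ^ 2) (e₂ : x₁ * x₂ + x₁ * x₃ + x₂ * x₃ = A - 2 * ℓ * m)
    (e₃ : x₁ * x₂ * x₃ = m ^ 2 - B) (ht : x₁ = x₂ → y₁ = y₂ ∧ 2 * y₁ * ℓ = 3 * x₁ ^ 2 + A)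
    (hD : 1 - A * (x₂ / y₂) * (1 / y₁ + 1 / y₂) -
      B * ((1 / y₁) ^ 2 + 1 / y₁ * (1 / y₂) + (1 / y₂) ^ 2) ≠ 0)
    (hlam : lam * (1 - A * (x₂ / y₂) * (1 / y₁ + 1 / y₂) -
      B * ((1 / y₁) ^ 2 + 1 / y₁ * (1 / y₂) + (1 / y₂) ^ 2)) =
      (x₁ / y₁) ^ 2 + x₁ / y₁ * (x₂ / y₂) + (x₂ / y₂) ^ 2 + A * (1 / y₁) ^ 2)
    (hnu : nu = 1 / y₁ - lam * (x₁ / y₁)) (hN : 1 + A * lam ^ 2 + B * lam ^ 3 ≠ 0) :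
    y₃ ≠ 0 ∧ x₃ / y₃ = x₁ / y₁ + x₂ / y₂ +
      (2 * A * lam * nu + 3 * B * lam ^ 2 * nu) / (1 + A * lam ^ 2 + B * lam ^ 3) ∧
    1 / y₃ = lam * (x₃ / y₃) - nu := by
  set D := 1 - A * (x₂ / y₂) * (1 / y₁ + 1 / y₂) -
      B * ((1 / y₁) ^ 2 + 1 / y₁ * (1 / y₂) + (1 / y₂) ^ 2) with hDdef
  have c₁ : y₁ ^ 2 = x₁ ^ 3 + A * x₁ + B := by
    rw [l₁]; linear_combination (-x₁ ^ 2) * e₁ + x₁ * e₂ - e₃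
  have c₂ : y₂ ^ 2 = x₂ ^ 3 + A * x₂ + B := by
    rw [l₂]; linear_combination (-x₂ ^ 2) * e₁ + x₂ * e₂ - e₃
  -- the two points in the coordinates `z`, `w`
  have d : (1 / y₁ - 1 / y₂) * D = (x₁ / y₁ - x₂ / y₂) *
      ((x₁ / y₁) ^ 2 + x₁ / y₁ * (x₂ / y₂) + (x₂ / y₂) ^ 2 + A * (1 / y₁) ^ 2) := by
    have w₁ : 1 / y₁ = (x₁ / y₁) ^ 3 + A * (x₁ / y₁) * (1 / y₁) ^ 2 + B * (1 / y₁) ^ 3 := by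
      field_simp; linear_combination c₁
    have w₂ : 1 / y₂ = (x₂ / y₂) ^ 3 + A * (x₂ / y₂) * (1 / y₂) ^ 2 + B * (1 / y₂) ^ 3 := by
      field_simp; linear_combination c₂
    rw [hDdef]
    linear_combination w₁ - w₂
  have tangent : x₁ / y₁ = x₂ / y₂ → x₁ = x₂ ∧ y₁ = y₂ ∧ 2 * y₁ * ℓ = 3 * x₁ ^ 2 + A ∧
      y₁ ^ 2 * D = x₁ ^ 3 - A * x₁ - 2 * B := by
    intro hz
    have hw : 1 / y₁ = 1 / y₂ := by
      rw [hz, sub_self, zero_mul] at d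
      exact sub_eq_zero.1 ((mul_eq_zero.1 d).resolve_right hD)
    have hyy : y₁ = y₂ := by simpa using hw
    have hxx : x₁ = x₂ := by
      rw [hyy] at hz
      field_simp at hz
      exact hz
    refine ⟨hxx, hyy, (ht hxx).2, ?_⟩
    rw [hDdef, ← hxx, ← hyy]
    field_simp
    linear_combination c₁
  have hm : m ≠ 0 := by
    rintro rfl
    have hℓ : ℓ ≠ 0 := by rintro rfl; simp at l₁; exact hy₁ l₁
    have hx₁ : x₁ ≠ 0 := by rintro rfl; simp at l₁; exact hy₁ l₁
    have hx₂ : x₂ ≠ 0 := by rintro rfl; simp at l₂; exact hy₂ l₂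
    have hz : x₁ / y₁ = x₂ / y₂ := by
      rw [l₁, l₂]; field_simp; ring
    obtain ⟨-, -, t, hDD⟩ := tangent hz
    have : y₁ ^ 2 * D = 0 := by
      rw [hDD]
      linear_combination 2 * c₁ - x₁ * t - 2 * y₁ * l₁
    exact (mul_ne_zero (pow_ne_zero 2 hy₁) hD) this
  have hlam' : lam = -ℓ / m := by
    apply mul_right_cancel₀ hD
    rw [hlam]
    by_cases hz : x₁ / y₁ = x₂ / y₂
    · obtain ⟨hxx, hyy, t, hDD⟩ := tangent hz
      apply mul_left_cancel₀ (pow_ne_zero 2 hy₁)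
      have : y₁ ^ 2 * (-ℓ / m * D) = -ℓ / m * (y₁ ^ 2 * D) := by ring
      rw [this, hDD, ← hxx, ← hyy]
      field_simp
      have hmm : 2 * y₁ * m = -(x₁ ^ 3 - A * x₁ - 2 * B) := by
        linear_combination (-2 * y₁) * l₁ - x₁ * t + 2 * c₁
      have h2 : (2 * y₁) ≠ 0 := mul_ne_zero two_ne_zero hy₁
      apply mul_left_cancel₀ h2
      linear_combination (3 * x₁ ^ 2 + A) * hmm - (x₁ ^ 3 - A * x₁ - 2 * B) * (-t)
    · apply mul_left_cancel₀ (sub_ne_zero.2 hz)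
      rw [← d]
      have : 1 / y₁ - 1 / y₂ = (x₁ / y₁ - x₂ / y₂) * (-ℓ / m) := by
        field_simp
        linear_combination y₁ * l₂ - y₂ * l₁
      rw [this]; ring
  have hnu' : nu = 1 / m := by
    rw [hnu, hlam']
    field_simp
    linear_combination -l₁
  -- the product of the three values of `ℓ x + m`
  have prod : y₁ * y₂ * (-y₃) = m ^ 3 * (1 + A * lam ^ 2 + B * lam ^ 3) := by
    rw [hlam', l₁, l₂, l₃]
    field_simp
    linear_combination ℓ ^ 3 * e₃ + ℓ ^ 2 * m * e₂ + ℓ * m ^ 2 * e₁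
  have hy₃ : y₃ ≠ 0 := by
    rintro rfl
    exact (mul_ne_zero (pow_ne_zero 3 hm) hN) (by rw [← prod]; simp)
  refine ⟨hy₃, ?_, ?_⟩
  · have hsum : x₁ / y₁ + x₂ / y₂ - x₃ / y₃ =
        (2 * A * ℓ * m - 3 * B * ℓ ^ 2) / (y₁ * y₂ * (-y₃)) := by
      field_simp
      have : y₁ * x₂ * y₃ + x₁ * y₂ * y₃ - y₁ * y₂ * x₃ =
          -((ℓ * x₁ + m) * x₂ * (ℓ * x₃ + m) + x₁ * (ℓ * x₂ + m) * (ℓ * x₃ + m) +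
            (ℓ * x₁ + m) * (ℓ * x₂ + m) * x₃) := by
        rw [← l₁, ← l₂, ← l₃]; ring
      linear_combination this - 3 * ℓ ^ 2 * e₃ - 2 * ℓ * m * e₂ - m ^ 2 * e₁
    have : x₃ / y₃ = x₁ / y₁ + x₂ / y₂ -
        (2 * A * ℓ * m - 3 * B * ℓ ^ 2) / (y₁ * y₂ * (-y₃)) := by rw [← hsum]; ring
    rw [this, prod, hnu', sub_eq_add_neg, add_right_inj, ← neg_div]
    rw [div_eq_div_iff (mul_ne_zero (pow_ne_zero 3 hm) hN) hN]
    rw [hlam']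
    field_simp
    ring
  · rw [hlam', hnu']
    field_simp
    linear_combination -l₃

end Chord


/-! ### Points reducing to the point at infinity -/

section Integrality

variable {A B : ℤ}

/-- For a valuation `v` that is at most `1` on `ℤ`, the affine points with `1 < v x` are those that
reduce to the point at infinity, i.e. those whose coordinates `x / y` and `1 / y` both have
valuation less than `1`. -/
lemma one_lt_valuation_x_iff {Γ₀ : Type*} [LinearOrderedCommGroupWithZero Γ₀] (v : Valuation ℚ Γ₀)
    (hA : v A ≤ 1) (hB : v B ≤ 1) {x y : ℚ} (h : y ^ 2 = x ^ 3 + A * x + B) :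
    1 < v x ↔ y ≠ 0 ∧ v (x / y) < 1 ∧ v (1 / y) < 1 := by
  constructor
  · intro hx
    have hlow : v (A * x + B) < v (x ^ 3) := by
      have h1 : v x < v (x ^ 3) := by
        rw [map_pow]; exact lt_self_pow₀ hx (by norm_num)
      refine v.map_add_lt ?_ ((hB.trans_lt hx).trans h1)
      rw [map_mul]
      exact (mul_le_of_le_one_left' hA).trans_lt h1
    have hyx : v y ^ 2 = v x ^ 3 := by
      rw [← map_pow, h, add_assoc, v.map_add_eq_of_lt_left hlow, map_pow]
    have hxy : v x < v y := by
      refine lt_of_pow_lt_pow_left₀ 2 zero_le ?_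
      rw [hyx]
      exact pow_lt_pow_right₀ hx (by norm_num)
    have hy : 0 < v y := zero_le.trans_lt hxy
    refine ⟨(v.pos_iff).1 hy, ?_, ?_⟩
    · rw [map_div₀]; exact (div_lt_one₀ hy).2 hxy
    · rw [map_div₀, map_one]; exact (div_lt_one₀ hy).2 (hx.trans hxy)
  · rintro ⟨hy, -, hw⟩
    by_contra! hx
    have hy' : 0 < v y := (v.pos_iff).2 hy
    rw [map_div₀, map_one, div_lt_one₀ hy'] at hw
    have : v y ^ 2 ≤ 1 := by
      rw [← map_pow, h]
      refine v.map_add_le (v.map_add_le ?_ ?_) hB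
      · rw [map_pow]; exact pow_le_one₀ zero_le hx
      · rw [map_mul]; exact mul_le_one₀ hA zero_le hx
    exact absurd this (not_le.2 (one_lt_pow₀ hw (by norm_num)))

/-- The points reducing to the point at infinity are closed under addition. -/
lemma one_lt_valuation_x_add {Γ₀ : Type*} [LinearOrderedCommGroupWithZero Γ₀] (v : Valuation ℚ Γ₀)
    (hA : v A ≤ 1) (hB : v B ≤ 1) {x₁ y₁ x₂ y₂ x₃ y₃ : ℚ}
    {h₁ : ((shortCurve A B)⁄ℚ).toAffine.Nonsingular x₁ y₁}
    {h₂ : ((shortCurve A B)⁄ℚ).toAffine.Nonsingular x₂ y₂}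
    {h₃ : ((shortCurve A B)⁄ℚ).toAffine.Nonsingular x₃ y₃}
    (h : (Affine.Point.some x₁ y₁ h₁ + Affine.Point.some x₂ y₂ h₂ : RatPoint A B) =
      Affine.Point.some x₃ y₃ h₃) (hx₁ : 1 < v x₁) (hx₂ : 1 < v x₂) : 1 < v x₃ := by
  have hne : ¬(x₁ = x₂ ∧ y₁ = -y₂) := by
    rintro ⟨hx, hy⟩
    rw [Affine.Point.add_of_Y_eq hx (by rw [shortCurve_negY, hy])] at h
    exact Affine.Point.some_ne_zero h₃ h.symm
  obtain ⟨ℓ, m, x, y, h', e, l₁, l₂, l₃, e₁, e₂, e₃, ht⟩ := exists_add_some h₁ h₂ hne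
  rw [e] at h
  obtain ⟨rfl, rfl⟩ := (Affine.Point.some.injEq ..).mp h
  obtain ⟨hy₁, hz₁, hw₁⟩ := (one_lt_valuation_x_iff v hA hB (shortCurve_equation.1 h₁.left)).1 hx₁
  obtain ⟨hy₂, hz₂, hw₂⟩ := (one_lt_valuation_x_iff v hA hB (shortCurve_equation.1 h₂.left)).1 hx₂
  rw [one_lt_valuation_x_iff v hA hB (shortCurve_equation.1 h₃.left)]
  have mulr {a b : ℚ} (ha : v a < 1) (hb : v b ≤ 1) : v (a * b) < 1 := by
    rw [map_mul]; exact mul_lt_one_of_nonneg_of_lt_one_left zero_le ha hb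
  have mull {a b : ℚ} (ha : v a ≤ 1) (hb : v b < 1) : v (a * b) < 1 := by
    rw [mul_comm]; exact mulr hb ha
  have hint (k : ℕ) : v k ≤ 1 := by
    induction k with
    | zero => simp
    | succ k ih => push_cast; exact v.map_add_le ih v.map_one.le
  set z₁ := x₁ / y₁
  set z₂ := x₂ / y₂
  set w₁ := 1 / y₁
  set w₂ := 1 / y₂
  set D := 1 - A * z₂ * (w₁ + w₂) - B * (w₁ ^ 2 + w₁ * w₂ + w₂ ^ 2) with hDdef
  have hD : v D = 1 := by
    rw [hDdef, sub_sub]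
    refine v.map_one_sub_of_lt (v.map_add_lt (mulr (mull hA hz₂) (v.map_add_le hw₁.le hw₂.le))
      (mull hB (v.map_add_lt (v.map_add_lt ?_ (mulr hw₁ hw₂.le)) ?_)))
    · rw [sq]; exact mulr hw₁ hw₁.le
    · rw [sq]; exact mulr hw₂ hw₂.le
  have hD0 : D ≠ 0 := by intro h0; simp [h0] at hD
  obtain ⟨lam, hlam⟩ : ∃ lam, lam = (z₁ ^ 2 + z₁ * z₂ + z₂ ^ 2 + A * w₁ ^ 2) / D := ⟨_, rfl⟩
  obtain ⟨nu, hnu⟩ : ∃ nu, nu = w₁ - lam * z₁ := ⟨_, rfl⟩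
  have hlam1 : v lam < 1 := by
    rw [hlam, map_div₀, hD, div_one]
    refine v.map_add_lt (v.map_add_lt (v.map_add_lt ?_ (mulr hz₁ hz₂.le)) ?_) (mull hA ?_)
    · rw [sq]; exact mulr hz₁ hz₁.le
    · rw [sq]; exact mulr hz₂ hz₂.le
    · rw [sq]; exact mulr hw₁ hw₁.le
  have hnu1 : v nu < 1 := by
    rw [hnu]; exact v.map_sub_lt hw₁ (mulr hlam1 hz₁.le)
  have hlam2 : v (lam ^ 2) < 1 := by rw [sq]; exact mulr hlam1 hlam1.le
  have hlam3 : v (lam ^ 3) < 1 := by rw [pow_succ]; exact mulr hlam2 hlam1.le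
  have hN : v (1 + A * lam ^ 2 + B * lam ^ 3) = 1 := by
    rw [add_assoc]
    exact v.map_one_add_of_lt (v.map_add_lt (mull hA hlam2) (mull hB hlam3))
  have hN0 : 1 + A * lam ^ 2 + B * lam ^ 3 ≠ 0 := by intro h0; simp [h0] at hN
  obtain ⟨hy₃, hz₃, hw₃⟩ := chord_at_infinity hy₁ hy₂ l₁ l₂ l₃ e₁ e₂ e₃ ht hD0
    (by rw [hlam, div_mul_cancel₀ _ hD0]) hnu hN0
  have hz₃' : v (x / y) < 1 := by
    rw [hz₃]
    refine v.map_add_lt (v.map_add_lt hz₁ hz₂) ?_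
    rw [map_div₀, hN, div_one]
    refine v.map_add_lt (mull ?_ hnu1) (mull ?_ hnu1)
    · exact (mull (by rw [map_mul]; exact mul_le_one₀ (mod_cast hint 2) zero_le hA) hlam1).le
    · exact (mull (by rw [map_mul]; exact mul_le_one₀ (mod_cast hint 3) zero_le hB) hlam2).le
  refine ⟨hy₃, hz₃', ?_⟩
  rw [hw₃]
  exact v.map_sub_lt (mulr hlam1 hz₃'.le) hnu1

/-- If a multiple of a point of infinite order has an integral `x`-coordinate, so has the point:
a denominator of `x(P)` would persist in all multiples of `P`. -/
lemma exists_int_x_of_nsmul {P : RatPoint A B} (hP : ¬IsOfFinAddOrder P) {n : ℕ} (hn : n ≠ 0)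
    {x y : ℚ} {h : ((shortCurve A B)⁄ℚ).toAffine.Nonsingular x y} (hPx : P = .some x y h)
    {a : ℤ} {y' : ℚ} {h' : ((shortCurve A B)⁄ℚ).toAffine.Nonsingular a y'}
    (hnP : n • P = .some (a : ℚ) y' h') : ∃ b : ℤ, x = b := by
  by_contra hx
  have hden : x.den ≠ 1 := fun hd ↦ hx ⟨x.num, (Rat.den_eq_one_iff x).1 hd |>.symm⟩
  obtain ⟨p, hp, hpd⟩ := Nat.exists_prime_and_dvd hden
  have : Fact p.Prime := ⟨hp⟩
  have hZ (k : ℤ) : Rat.padicValuation p k ≤ 1 := by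
    rw [Rat.padicValuation_cast]; exact Int.padicValuation_le_one p k
  have hxp : 1 < Rat.padicValuation p x := by
    rw [← not_le, Rat.padicValuation_le_one_iff]; exact not_not.2 hpd
  have key (k : ℕ) : ∀ (X Y : ℚ) (H : ((shortCurve A B)⁄ℚ).toAffine.Nonsingular X Y),
      (k + 1) • P = .some X Y H → 1 < Rat.padicValuation p X := by
    induction k with
    | zero =>
      intro X Y H hk
      rw [zero_add, one_smul, hPx] at hk
      obtain ⟨rfl, rfl⟩ := (Affine.Point.some.injEq ..).mp hk
      exact hxp
    | succ k ih =>
      intro X Y H hk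
      rw [succ_nsmul] at hk
      rcases hQ : (k + 1) • P with _ | ⟨X', Y', H'⟩
      · exact absurd (isOfFinAddOrder_iff_nsmul_eq_zero.2 ⟨k + 1, k.succ_pos, hQ⟩) hP
      · rw [hQ, hPx] at hk
        exact one_lt_valuation_x_add _ (hZ A) (hZ B) hk (ih _ _ _ hQ) hxp
  obtain ⟨k, rfl⟩ := Nat.exists_eq_succ_of_ne_zero hn
  exact (not_lt.2 (hZ a)) (key k _ _ _ hnP)

end Integrality


/-! ### Real points near infinity -/

section Archimedean

/-- The group law near the point at infinity over an ordered field: in the coordinates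
`z = x / y`, `w = 1 / y` the line through two points that are close to the origin has slope
`lam ≈ z₁² + z₁ z₂ + z₂²` and intercept `nu ≈ -z₁ z₂ (z₁ + z₂)`, and the deviation of `z` from
additivity is small compared to `z₁`. Here `T / 4` bounds the coefficients of the curve. -/
lemma chord_estimates {A B T z₁ z₂ w₁ w₂ D lam nu : ℚ} (hT : 4 ≤ T) (hA : |A| ≤ T / 4)
    (hB : |B| ≤ T / 4) (hz₁ : 0 < z₁) (hz₂ : 0 < z₂) (hTz₁ : T * z₁ ≤ 1) (hTz₂ : T * z₂ ≤ 1)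
    (hw₁ : 0 < w₁) (hw₂ : 0 < w₂) (hwz₁ : w₁ ≤ 2 * z₁ ^ 3) (hwz₂ : w₂ ≤ 2 * z₂ ^ 3)
    (hc : w₁ = z₁ ^ 3 + A * z₁ * w₁ ^ 2 + B * w₁ ^ 3)
    (hD : D = 1 - A * z₂ * (w₁ + w₂) - B * (w₁ ^ 2 + w₁ * w₂ + w₂ ^ 2))
    (hlam : lam = (z₁ ^ 2 + z₁ * z₂ + z₂ ^ 2 + A * w₁ ^ 2) / D) (hnu : nu = w₁ - lam * z₁) :
    0 < D ∧ 0 < lam ∧ lam ≤ 26 / 25 * (z₁ + z₂) ^ 2 ∧ nu < 0 ∧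
      -nu ≤ 11 / 10 * (z₁ * z₂ * (z₁ + z₂)) ∧ 9 / 10 ≤ 1 + A * lam ^ 2 + B * lam ^ 3 ∧
      |2 * A * lam * nu + 3 * B * lam ^ 2 * nu| ≤ z₁ / 10 := by
  have z4₁ : z₁ ≤ 1 / 4 := by linarith [mul_le_mul_of_nonneg_right hT hz₁.le]
  have z4₂ : z₂ ≤ 1 / 4 := by linarith [mul_le_mul_of_nonneg_right hT hz₂.le]
  have Tw₁ : T * w₁ ≤ 2 * z₁ ^ 2 := by
    calc T * w₁ ≤ T * (2 * z₁ ^ 3) := by gcongr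
      _ = (T * z₁) * (2 * z₁ ^ 2) := by ring
      _ ≤ 1 * (2 * z₁ ^ 2) := by gcongr
      _ = _ := one_mul _
  have Tw₂ : T * w₂ ≤ 2 * z₂ ^ 2 := by
    calc T * w₂ ≤ T * (2 * z₂ ^ 3) := by gcongr
      _ = (T * z₂) * (2 * z₂ ^ 2) := by ring
      _ ≤ 1 * (2 * z₂ ^ 2) := by gcongr
      _ = _ := one_mul _
  have zz₁ : z₁ ^ 2 ≤ 1 / 16 := (pow_le_pow_left₀ hz₁.le z4₁ 2).trans (by norm_num)
  have zz₂ : z₂ ^ 2 ≤ 1 / 16 := (pow_le_pow_left₀ hz₂.le z4₂ 2).trans (by norm_num)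
  have w8₁ : w₁ ≤ z₁ / 8 := by linarith [mul_le_mul_of_nonneg_left zz₁ hz₁.le]
  have w8₂ : w₂ ≤ z₂ / 8 := by linarith [mul_le_mul_of_nonneg_left zz₂ hz₂.le]
  have w32₁ : w₁ ≤ 1 / 32 := by linarith
  have w32₂ : w₂ ≤ 1 / 32 := by linarith
  obtain ⟨p, hp⟩ : ∃ p, p = z₁ + z₂ := ⟨_, rfl⟩
  have hp0 : 0 < p := by linarith
  have p2 : p ≤ 1 / 2 := by linarith
  have Tp : T * p ≤ 2 := by rw [hp]; linarith
  have hww : w₁ + w₂ ≤ p / 8 := by linarith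
  have mulA {c : ℚ} (hc : 0 ≤ c) : |A * c| ≤ T / 4 * c := by
    rw [abs_mul, abs_of_nonneg hc]; gcongr
  have mulB {c : ℚ} (hc : 0 ≤ c) : |B * c| ≤ T / 4 * c := by
    rw [abs_mul, abs_of_nonneg hc]; gcongr
  -- `D` is close to `1`
  have D₁ : |A * (z₂ * (w₁ + w₂))| ≤ 1 / 64 := by
    refine (mulA (by positivity)).trans ?_
    calc T / 4 * (z₂ * (w₁ + w₂)) = (T * z₂) * (w₁ + w₂) / 4 := by ring
      _ ≤ 1 * (1 / 16) / 4 := by gcongr; linarith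
      _ = _ := by norm_num
  have D₂ : |B * (w₁ ^ 2 + w₁ * w₂ + w₂ ^ 2)| ≤ 3 / 1024 := by
    refine (mulB (by positivity)).trans ?_
    calc T / 4 * (w₁ ^ 2 + w₁ * w₂ + w₂ ^ 2)
        = (T * w₁) * (w₁ + w₂) / 4 + (T * w₂) * w₂ / 4 := by ring
      _ ≤ (2 * z₁ ^ 2) * (1 / 32 + 1 / 32) / 4 + (2 * z₂ ^ 2) * (1 / 32) / 4 := by gcongr
      _ ≤ _ := by linarith
  have hDu : D ≤ 51 / 50 := by
    rw [hD]; linarith [neg_le_of_abs_le D₁, neg_le_of_abs_le D₂]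
  have hDl : 49 / 50 ≤ D := by
    rw [hD]; linarith [le_of_abs_le D₁, le_of_abs_le D₂]
  have hD0 : 0 < D := by linarith
  -- the slope
  obtain ⟨q, hq⟩ : ∃ q, q = z₁ ^ 2 + z₁ * z₂ + z₂ ^ 2 := ⟨_, rfl⟩
  have hq0 : 0 < q := by rw [hq]; positivity
  have hqp : q ≤ p ^ 2 := by rw [hq, hp]; linarith [mul_pos hz₁ hz₂]
  have R₁ : |A * w₁ ^ 2| ≤ q / 64 := by
    refine (mulA (by positivity)).trans ?_
    calc T / 4 * w₁ ^ 2 = (T * w₁) * w₁ / 4 := by ring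
      _ ≤ (2 * z₁ ^ 2) * (1 / 32) / 4 := by gcongr
      _ ≤ q / 64 := by rw [hq]; linarith [mul_pos hz₁ hz₂, sq_nonneg z₂]
  replace hlam : lam * D = q + A * w₁ ^ 2 := by rw [hlam, hq, div_mul_cancel₀ _ hD0.ne']
  have lamD : lam * D ≤ 65 / 64 * q := by linarith [le_of_abs_le R₁]
  have lamD' : 63 / 64 * q ≤ lam * D := by linarith [neg_le_of_abs_le R₁]
  have lam0 : 0 < lam := by
    refine pos_of_mul_pos_left (b := D) ?_ hD0.le
    linarith
  have lamq : lam ≤ 26 / 25 * q := by linarith [mul_le_mul_of_nonneg_left hDl lam0.le]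
  have lamp : lam ≤ 26 / 25 * p ^ 2 := lamq.trans (by gcongr)
  -- the intercept
  obtain ⟨k, hk⟩ : ∃ k, k = z₁ * z₂ * p := ⟨_, rfl⟩
  have hk0 : 0 < k := by rw [hk]; positivity
  have nuD : nu * D = -k - A * (z₂ * w₁ * (w₁ + w₂)) - B * (w₁ * w₂ * (w₁ + w₂)) := by
    rw [hnu, sub_mul, mul_right_comm lam, hlam, hD, hk, hq, hp]
    linear_combination hc
  have N₁ : |A * (z₂ * w₁ * (w₁ + w₂))| ≤ k / 64 := by
    refine (mulA (by positivity)).trans ?_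
    calc T / 4 * (z₂ * w₁ * (w₁ + w₂)) = (T * w₁) * (z₂ * (w₁ + w₂)) / 4 := by ring
      _ ≤ (2 * z₁ ^ 2) * (z₂ * (p / 8)) / 4 := by gcongr
      _ = k * z₁ / 16 := by rw [hk]; ring
      _ ≤ k * (1 / 4) / 16 := by gcongr
      _ = _ := by ring
  have N₂ : |B * (w₁ * w₂ * (w₁ + w₂))| ≤ k / 64 := by
    refine (mulB (by positivity)).trans ?_
    calc T / 4 * (w₁ * w₂ * (w₁ + w₂)) = (T * w₁) * (w₂ * (w₁ + w₂)) / 4 := by ring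
      _ ≤ (2 * z₁ ^ 2) * (z₂ / 8 * (p / 8)) / 4 := by gcongr
      _ = k * z₁ / 128 := by rw [hk]; ring
      _ ≤ k * (1 / 4) / 128 := by gcongr
      _ ≤ _ := by linarith
  have nuu : nu * D ≤ -(31 / 32) * k := by
    rw [nuD]; linarith [neg_le_of_abs_le N₁, neg_le_of_abs_le N₂]
  have nul : -(33 / 32) * k ≤ nu * D := by
    rw [nuD]; linarith [le_of_abs_le N₁, le_of_abs_le N₂]
  have nu0 : nu < 0 := by
    by_contra! h
    have := mul_nonneg h hD0.le
    linarith
  have nuk : -nu ≤ 11 / 10 * k := by linarith [mul_le_mul_of_nonpos_left hDl nu0.le]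
  have pp : p ^ 2 ≤ 1 / 4 := (pow_le_pow_left₀ hp0.le p2 2).trans (by norm_num)
  have lam13 : lam ≤ 13 / 50 := by linarith
  -- the denominator
  have Al : |A * lam ^ 2| ≤ 7 / 100 := by
    refine (mulA (by positivity)).trans ?_
    calc T / 4 * lam ^ 2 ≤ T / 4 * (26 / 25 * p ^ 2) ^ 2 := by gcongr
      _ = (T * p) * p * p ^ 2 * (26 / 25) ^ 2 / 4 := by ring
      _ ≤ 2 * (1 / 2) * (1 / 4) * (26 / 25) ^ 2 / 4 := by gcongr
      _ ≤ _ := by norm_num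
  have Bl : |B * lam ^ 3| ≤ 2 / 100 := by
    refine (mulB (by positivity)).trans ?_
    calc T / 4 * lam ^ 3 ≤ T / 4 * (26 / 25 * p ^ 2) ^ 3 := by gcongr
      _ = (T * p) * p * p ^ 2 * p ^ 2 * (26 / 25) ^ 3 / 4 := by ring
      _ ≤ 2 * (1 / 2) * (1 / 4) * (1 / 4) * (26 / 25) ^ 3 / 4 := by gcongr
      _ ≤ _ := by norm_num
  -- the deviation from additivity
  have E₁ : |A * (lam * -nu)| ≤ 36 / 1000 * z₁ := by
    refine (mulA (mul_nonneg lam0.le (by linarith))).trans ?_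
    calc T / 4 * (lam * -nu) ≤ T / 4 * ((26 / 25 * p ^ 2) * (11 / 10 * k)) := by
          gcongr
          linarith
      _ = (T * z₂) * p * p ^ 2 * z₁ * (26 / 25 * (11 / 10) / 4) := by rw [hk]; ring
      _ ≤ 1 * (1 / 2) * (1 / 4) * z₁ * (26 / 25 * (11 / 10) / 4) := by gcongr
      _ ≤ _ := by linarith
  have E₂ : |B * (lam ^ 2 * -nu)| ≤ 93 / 10000 * z₁ := by
    refine (mulB (mul_nonneg (by positivity) (by linarith))).trans ?_
    calc T / 4 * (lam ^ 2 * -nu) ≤ T / 4 * ((26 / 25 * p ^ 2) ^ 2 * (11 / 10 * k)) := by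
          gcongr
          linarith
      _ = (T * z₂) * p * p ^ 2 * p ^ 2 * z₁ * ((26 / 25) ^ 2 * (11 / 10) / 4) := by rw [hk]; ring
      _ ≤ 1 * (1 / 2) * (1 / 4) * (1 / 4) * z₁ * ((26 / 25) ^ 2 * (11 / 10) / 4) := by gcongr
      _ ≤ _ := by linarith
  rw [← hp, ← hk]
  refine ⟨hD0, lam0, lamp, nu0, nuk, ?_, ?_⟩
  · linarith [neg_le_of_abs_le Al, neg_le_of_abs_le Bl]
  · have : 2 * A * lam * nu + 3 * B * lam ^ 2 * nu =
        -(2 * (A * (lam * -nu)) + 3 * (B * (lam ^ 2 * -nu))) := by ring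
    rw [this, abs_neg, abs_le]
    constructor
    · linarith [neg_le_of_abs_le E₁, neg_le_of_abs_le E₂]
    · linarith [le_of_abs_le E₁, le_of_abs_le E₂]

variable {A B : ℤ}

/-- The rational point `(x, y)` lies near the point at infinity, on the side `0 < y`, for the real
topology: `z = x / y` is at most `1 / T`, and `w = 1 / y` is at most twice its leading term `z³`. -/
def NearInfinity (T x y : ℚ) : Prop :=
  0 < y ∧ 0 < x / y ∧ T * (x / y) ≤ 1 ∧ 1 / y ≤ 2 * (x / y) ^ 3

/-- Addition of points near infinity is almost additive in the coordinate `x / y`. -/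
lemma exists_add_of_nearInfinity {T : ℚ} (hT : 4 ≤ T) (hA : |(A : ℚ)| ≤ T / 4)
    (hB : |(B : ℚ)| ≤ T / 4) {x₁ y₁ x₂ y₂ : ℚ}
    (h₁ : ((shortCurve A B)⁄ℚ).toAffine.Nonsingular x₁ y₁)
    (h₂ : ((shortCurve A B)⁄ℚ).toAffine.Nonsingular x₂ y₂)
    (hn₁ : NearInfinity T x₁ y₁) (hn₂ : NearInfinity T x₂ y₂) :
    ∃ (x₃ y₃ : ℚ) (h₃ : ((shortCurve A B)⁄ℚ).toAffine.Nonsingular x₃ y₃),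
      (Affine.Point.some x₁ y₁ h₁ + Affine.Point.some x₂ y₂ h₂ : RatPoint A B) =
        Affine.Point.some x₃ y₃ h₃ ∧ 0 < y₃ ∧ 1 / y₃ ≤ 2 * (x₃ / y₃) ^ 3 ∧
      x₂ / y₂ + x₁ / y₁ / 2 ≤ x₃ / y₃ ∧ x₃ / y₃ ≤ x₂ / y₂ + 3 / 2 * (x₁ / y₁) := by
  obtain ⟨hy₁, hz₁, hT₁, hw₁⟩ := hn₁
  obtain ⟨hy₂, hz₂, hT₂, hw₂⟩ := hn₂
  obtain ⟨ℓ, m, x₃, y₃, h₃, e, l₁, l₂, l₃, e₁, e₂, e₃, ht⟩ :=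
    exists_add_some h₁ h₂ (by rintro ⟨-, h⟩; linarith)
  refine ⟨x₃, y₃, h₃, e, ?_⟩
  have c₁ := shortCurve_equation.1 h₁.left
  have c₃ := shortCurve_equation.1 h₃.left
  have hc : 1 / y₁ = (x₁ / y₁) ^ 3 + A * (x₁ / y₁) * (1 / y₁) ^ 2 + B * (1 / y₁) ^ 3 := by
    field_simp; linear_combination c₁
  obtain ⟨D, hD⟩ : ∃ D, D = 1 - A * (x₂ / y₂) * (1 / y₁ + 1 / y₂) -
      B * ((1 / y₁) ^ 2 + 1 / y₁ * (1 / y₂) + (1 / y₂) ^ 2) := ⟨_, rfl⟩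
  obtain ⟨lam, hlam⟩ : ∃ lam, lam = ((x₁ / y₁) ^ 2 + x₁ / y₁ * (x₂ / y₂) + (x₂ / y₂) ^ 2 +
      A * (1 / y₁) ^ 2) / D := ⟨_, rfl⟩
  obtain ⟨nu, hnu⟩ : ∃ nu, nu = 1 / y₁ - lam * (x₁ / y₁) := ⟨_, rfl⟩
  obtain ⟨hD0, lam0, lamp, nu0, nuk, hN, hdev⟩ := chord_estimates hT hA hB hz₁ hz₂ hT₁ hT₂
    (by positivity) (by positivity) hw₁ hw₂ hc hD hlam hnu
  have hN0 : 0 < 1 + (A : ℚ) * lam ^ 2 + B * lam ^ 3 := by linarith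
  obtain ⟨hy₃, hz₃, hw₃⟩ := chord_at_infinity hy₁.ne' hy₂.ne' l₁ l₂ l₃ e₁ e₂ e₃ ht
    (hD ▸ hD0.ne') (by rw [← hD, hlam, div_mul_cancel₀ _ hD0.ne']) hnu hN0.ne'
  have hdev' : |(2 * A * lam * nu + 3 * B * lam ^ 2 * nu) /
      (1 + (A : ℚ) * lam ^ 2 + B * lam ^ 3)| ≤ x₁ / y₁ / 9 := by
    rw [abs_div, abs_of_pos hN0, div_le_iff₀ hN0]
    refine hdev.trans ?_
    linarith [mul_le_mul_of_nonneg_left hN hz₁.le]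
  obtain ⟨hdl, hdu⟩ := abs_le.1 hdev'
  rw [← sub_eq_iff_eq_add'] at hz₃
  rw [← hz₃] at hdl hdu
  have hc₃ : 1 / y₃ = (x₃ / y₃) ^ 3 + A * (x₃ / y₃) * (1 / y₃) ^ 2 + B * (1 / y₃) ^ 3 := by
    field_simp; linear_combination c₃
  obtain ⟨z, hz⟩ : ∃ z, z = x₃ / y₃ := ⟨_, rfl⟩
  obtain ⟨w, hw⟩ : ∃ w, w = 1 / y₃ := ⟨_, rfl⟩
  obtain ⟨p, hp⟩ : ∃ p, p = x₁ / y₁ + x₂ / y₂ := ⟨_, rfl⟩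
  rw [← hz, ← hw] at hc₃ hw₃
  rw [← hz] at hdl hdu
  rw [← hp] at lamp nuk
  have hp0 : 0 < p := by linarith
  have hTp : T * p ≤ 2 := by rw [hp]; linarith
  have hp2 : p ≤ 1 / 2 := by linarith [mul_le_mul_of_nonneg_right hT hp0.le]
  have hz0 : 0 < z := by linarith
  have hzp : z ≤ 10 / 9 * p := by linarith
  have hw0 : 0 < w := by
    rw [hw₃]
    linarith [mul_pos lam0 hz0]
  have hwp : w ≤ 3 / 2 * p ^ 3 := by
    have h1 : lam * z ≤ 26 / 25 * p ^ 2 * (10 / 9 * p) := by gcongr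
    have h2 : x₁ / y₁ * (x₂ / y₂) ≤ p ^ 2 / 4 := by
      rw [hp]; linarith [sq_nonneg (x₁ / y₁ - x₂ / y₂)]
    have h3 : x₁ / y₁ * (x₂ / y₂) * p ≤ p ^ 2 / 4 * p := by gcongr
    have h4 : 0 < p ^ 3 := by positivity
    rw [hw₃]
    linarith
  have hpp : p ^ 2 ≤ 1 / 4 := (pow_le_pow_left₀ hp0.le hp2 2).trans (by norm_num)
  have hw1 : w ≤ 3 / 16 := by
    refine hwp.trans ?_
    calc 3 / 2 * p ^ 3 = 3 / 2 * (p ^ 2 * p) := by ring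
      _ ≤ 3 / 2 * (1 / 4 * (1 / 2)) := by gcongr
      _ = _ := by norm_num
  have hTw : T * w ≤ 3 / 4 := by
    calc T * w ≤ T * (3 / 2 * p ^ 3) := by gcongr
      _ = 3 / 2 * (T * p) * p ^ 2 := by ring
      _ ≤ 3 / 2 * 2 * (1 / 4) := by gcongr
      _ = _ := by norm_num
  have hAz : A * z * w ^ 2 ≤ 3 / 16 * w := by
    calc A * z * w ^ 2 ≤ T / 4 * z * w ^ 2 := by gcongr; exact (le_abs_self _).trans hA
      _ = T * w * z * w / 4 := by ring
      _ ≤ 3 / 4 * 1 * w / 4 := by gcongr; linarith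
      _ = _ := by ring
  have hBw : B * w ^ 3 ≤ 3 / 16 * w := by
    calc B * w ^ 3 ≤ T / 4 * w ^ 3 := by gcongr; exact (le_abs_self _).trans hB
      _ = T * w * w * w / 4 := by ring
      _ ≤ 3 / 4 * 1 * w / 4 := by gcongr; linarith
      _ = _ := by ring
  rw [← hz, ← hw]
  refine ⟨by simpa [hw] using hw0, by linarith, by linarith, by linarith⟩

/-- A point with `0 < y` whose `x`-coordinate is at least `T² / 2` lies near infinity, and its
coordinate `x / y` is close to `x ^ (-1 / 2)`. -/
lemma bounds_of_large_x {T : ℚ} (hT : 4 ≤ T) (hA : |(A : ℚ)| ≤ T / 4)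
    (hB : |(B : ℚ)| ≤ T / 4) {x y : ℚ} (hxy : y ^ 2 = x ^ 3 + A * x + B) (hy : 0 < y)
    (hx : T ^ 2 ≤ 2 * x) :
    0 < x / y ∧ x * (x / y) ^ 2 ≤ 10 / 9 ∧ 1 / y ≤ 2 * (x / y) ^ 3 ∧ 1 ≤ 2 * (x * (x / y) ^ 2) := by
  have hT2 : 4 * T ≤ T ^ 2 := by rw [sq]; gcongr
  have hx8 : 8 ≤ x := by linarith
  have hx0 : 0 < x := by linarith
  have hA' := abs_le.1 hA
  have hB' := abs_le.1 hB
  have low : |A * x + B| ≤ x ^ 3 / 10 := by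
    calc |A * x + B| ≤ |(A : ℚ)| * x + |(B : ℚ)| := by
          refine (abs_add_le _ _).trans ?_
          rw [abs_mul, abs_of_pos hx0]
      _ ≤ (x / 8) * x + x / 8 := by gcongr <;> linarith
      _ ≤ x ^ 3 / 10 := by nlinarith [mul_pos hx0 hx0]
  obtain ⟨l, u⟩ := abs_le.1 low
  have hx3 : 0 < x ^ 3 := by positivity
  have e : x * (x / y) ^ 2 = x ^ 3 / y ^ 2 := by field_simp
  have hy2 : 0 < y ^ 2 := by positivity
  refine ⟨by positivity, ?_, ?_, ?_⟩
  · rw [e, div_le_iff₀ hy2]; linarith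
  · rw [div_pow, div_le_iff₀ hy]
    have : 2 * (x ^ 3 / y ^ 3) * y = 2 * x ^ 3 / y ^ 2 := by field_simp
    rw [this, le_div_iff₀ hy2]; linarith
  · rw [e]
    have : 1 / 2 ≤ x ^ 3 / y ^ 2 := by rw [le_div_iff₀ hy2]; linarith
    linarith

/-- If `x(P)` is large compared to `n²`, then the multiples of `P` up to `nP` do not wind around the
real curve, so that `x(nP)` is still positive and not much larger than `x(P)`. -/
lemma x_nsmul_le_of_large_x {T : ℚ} (hT : 4 ≤ T) (hA : |(A : ℚ)| ≤ T / 4)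
    (hB : |(B : ℚ)| ≤ T / 4) {x y : ℚ} (h : ((shortCurve A B)⁄ℚ).toAffine.Nonsingular x y)
    (hy : 0 < y) {n : ℕ} (hn : 2 ≤ n) (hx : 4 * n ^ 2 * T ^ 2 ≤ x) :
    ∃ (x' y' : ℚ) (h' : ((shortCurve A B)⁄ℚ).toAffine.Nonsingular x' y'),
      n • (Affine.Point.some x y h : RatPoint A B) = Affine.Point.some x' y' h' ∧
        0 < x' ∧ x' ≤ 4 * x := by
  have hn' : (2 : ℚ) ≤ n := by exact_mod_cast hn
  have hn2 : (1 : ℚ) ≤ 4 * n ^ 2 := by nlinarith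
  obtain ⟨hz0, hzx, hwz, hxz⟩ := bounds_of_large_x hT hA hB (shortCurve_equation.1 h.left) hy
    (by linarith [le_mul_of_one_le_left (sq_nonneg T) hn2, sq_nonneg T])
  obtain ⟨z, hz⟩ : ∃ z, z = x / y := ⟨_, rfl⟩
  -- the bound on `x` makes room for `n` steps, each of which changes `z` by at most `3 / 2 * z`
  have hTz : T * (3 / 2 * n * z) ≤ 1 := by
    rw [← hz] at hz0 hzx
    refine le_of_sq_le_sq ?_ zero_le_one
    have : 4 * n ^ 2 * T ^ 2 * z ^ 2 ≤ 10 / 9 :=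
      (mul_le_mul_of_nonneg_right hx (sq_nonneg z)).trans hzx
    nlinarith
  have key (k : ℕ) (hk : k + 1 ≤ n) :
      ∃ (x' y' : ℚ) (h' : ((shortCurve A B)⁄ℚ).toAffine.Nonsingular x' y'),
      (k + 1) • (Affine.Point.some x y h : RatPoint A B) = Affine.Point.some x' y' h' ∧
      0 < y' ∧ 1 / y' ≤ 2 * (x' / y') ^ 3 ∧ (1 + k / 2) * z ≤ x' / y' ∧
      x' / y' ≤ (1 + 3 / 2 * k) * z := by
    induction k with
    | zero => exact ⟨x, y, h, by simp, hy, hwz, by simp [hz], by simp [hz]⟩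
    | succ k ih =>
      obtain ⟨x', y', h', e, hy', hw', hl, hu⟩ := ih (by lia)
      have hkn : ((k : ℚ) + 1) + 1 ≤ n := by exact_mod_cast hk
      have hk0 : (0 : ℚ) ≤ k := k.cast_nonneg
      rw [← hz] at hz0
      have hT' {c : ℚ} (hc : c ≤ 3 / 2 * n * z) : T * c ≤ 1 :=
        (mul_le_mul_of_nonneg_left hc (by linarith)).trans hTz
      have near : NearInfinity T x y := by
        refine ⟨hy, hz ▸ hz0, hT' ?_, hwz⟩
        rw [← hz]
        exact le_mul_of_one_le_left hz0.le (by linarith)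
      have near' : NearInfinity T x' y' := by
        refine ⟨hy', lt_of_lt_of_le (by positivity) hl, hT' (hu.trans ?_), hw'⟩
        gcongr
        linarith
      obtain ⟨x₃, y₃, h₃, e₃, hy₃, hw₃, hl₃, hu₃⟩ :=
        exists_add_of_nearInfinity hT hA hB h h' near near'
      refine ⟨x₃, y₃, h₃, ?_, hy₃, hw₃, ?_, ?_⟩
      · rw [succ_nsmul', e, e₃]
      · rw [← hz] at hl₃; push_cast; linarith
      · rw [← hz] at hu₃; push_cast; linarith
  obtain ⟨k, rfl⟩ := Nat.exists_eq_succ_of_ne_zero (by lia : n ≠ 0)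
  obtain ⟨x', y', h', e, hy', hw', hl, hu⟩ := key k le_rfl
  rw [← hz] at hz0 hxz
  have hzz : z ≤ x' / y' := (le_mul_of_one_le_left hz0.le (by simp; positivity)).trans hl
  have hz' : 0 < x' / y' := hz0.trans_le hzz
  have hx' : 0 < x' := by simpa [hy'] using (div_pos_iff_of_pos_right hy').1 hz'
  refine ⟨x', y', h', e, hx', ?_⟩
  -- `x'` and `x` are comparable to `z' ^ (-2)` and `z ^ (-2)`, and `z ≤ z'`
  have h2 : x' * (x' / y') ^ 2 ≤ 2 := by
    refine le_trans (bounds_of_large_x hT hA hB (shortCurve_equation.1 h'.left) hy' ?_).2.1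
      (by norm_num)
    have hTz' : T * (x' / y') ≤ 1 := by
      refine le_trans ?_ hTz
      gcongr
      refine hu.trans ?_
      gcongr
      push_cast
      linarith
    have h5 : 1 ≤ 2 * x' * (x' / y') ^ 2 := by
      rw [div_le_iff₀ hy'] at hw'
      refine hw'.trans_eq ?_
      field_simp
    refine le_of_mul_le_mul_right (le_trans ?_ h5) (pow_pos hz' 2)
    rw [← mul_pow]
    exact pow_le_one₀ (by positivity) hTz'
  have h3 : x' * z ^ 2 ≤ 2 := le_trans (by gcongr) h2
  have h4 : 0 < z ^ 2 := by positivity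
  refine le_of_mul_le_mul_right ?_ h4
  linarith

end Archimedean


/-! ### The parallelogram law for the naive height -/

section Parallelogram

variable {A B : ℤ}

lemma xHeight_eq_logHeight_xRep (P : RatPoint A B) : xHeight P = Height.logHeight P.xRep := by
  rcases P with _ | ⟨x, y, h⟩
  · change 0 = Height.logHeight (Affine.Point.xRep (0 : RatPoint A B))
    rw [Affine.Point.xRep_zero, Height.logHeight_swap]
    simp
  · rw [Affine.Point.xRep_some]
    exact Height.logHeight₁_eq_logHeight x

@[simp] lemma xHeight_zero : xHeight (0 : RatPoint A B) = 0 := rfl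

lemma addSubMap_shortCurve (s t u : ℚ) :
    (fun i ↦ (addSubMap ((shortCurve A B)⁄ℚ) i).eval ![s, t, u]) =
      ![s ^ 2 - 2 * A * s * u - 4 * B * t * u + A ^ 2 * u ^ 2,
        2 * t * s + 2 * A * t * u + 4 * B * u ^ 2, t ^ 2 - 4 * s * u] := by
  ext i
  fin_cases i <;>
    simp [addSubMap, WeierstrassCurve.b₂, WeierstrassCurve.b₄, WeierstrassCurve.b₆,
      WeierstrassCurve.b₈, shortCurve]

/-- The case `P = Q` of `addSubMap_sym2x`: the duplication formula for `x`. -/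
lemma addSubMap_sym2x_self (P : RatPoint A B) :
    ∃ c : ℚ, c ≠ 0 ∧ (fun i ↦ (addSubMap ((shortCurve A B)⁄ℚ) i).eval (P.sym2x P)) =
      c • (P + P).sym2x 0 := by
  rcases P with _ | ⟨x, y, h⟩
  · refine ⟨1, one_ne_zero, ?_⟩
    change (fun i ↦ (addSubMap ((shortCurve A B)⁄ℚ) i).eval
      (Affine.Point.sym2x (0 : RatPoint A B) 0)) = _
    rw [← Affine.Point.zero_def, add_zero, Affine.Point.sym2x_zero_zero, addSubMap_shortCurve]
    simp
  · have c := shortCurve_equation.1 h.left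
    rw [Affine.Point.sym2x_some_some, addSubMap_shortCurve]
    by_cases hy : y = 0
    · have hx : 3 * x ^ 2 + (A : ℚ) ≠ 0 := by
        have := ((Affine.nonsingular_iff ..).1 h).2
        rcases this with h1 | h1
        · intro h0
          apply h1
          simp only [shortCurve_a₁, shortCurve_a₂, shortCurve_a₄]
          linear_combination -h0
        · exact absurd (by simp [hy, shortCurve]) h1
      rw [Affine.Point.add_of_Y_eq rfl (by rw [shortCurve_negY, hy, neg_zero]),
        Affine.Point.sym2x_zero_zero]
      refine ⟨(3 * x ^ 2 + A) ^ 2, pow_ne_zero 2 hx, ?_⟩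
      rw [hy] at c
      ext i
      fin_cases i <;> simp
      · linear_combination (8 * x) * c
      · linear_combination (-4) * c
      · ring
    · obtain ⟨ℓ, m, x₃, y₃, h₃, e, -, -, -, e₁, -, -, ht⟩ := exists_add_some h h
        (by rintro ⟨-, h0⟩; exact hy (by linarith))
      rw [e, Affine.Point.sym2x_some_zero]
      refine ⟨4 * y ^ 2, mul_ne_zero four_ne_zero (pow_ne_zero 2 hy), ?_⟩
      have ht := (ht rfl).2
      have hx₃ : x₃ = ℓ ^ 2 - 2 * x := by linear_combination e₁
      ext i
      fin_cases i <;> simp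
      · rw [hx₃]
        linear_combination (-(2 * y * ℓ) - 3 * x ^ 2 - A) * ht + 8 * x * c
      · linear_combination (-4) * c
      · ring

/-- The map `addSubMap` computes `x(P + Q)` and `x(P - Q)` from `x(P)` and `x(Q)`. -/
lemma addSubMap_sym2x (P Q : RatPoint A B) :
    ∃ c : ℚ, c ≠ 0 ∧ (fun i ↦ (addSubMap ((shortCurve A B)⁄ℚ) i).eval (P.sym2x Q)) =
      c • (P + Q).sym2x (P - Q) := by
  by_cases hPQ : P = Q
  · rw [hPQ, sub_self]; exact addSubMap_sym2x_self Q
  by_cases hPQ' : P = -Q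
  · have := addSubMap_sym2x_self P
    rwa [← Affine.Point.sym2x_neg_right, Affine.Point.sym2x_comm _ 0, show -P = Q by simp [hPQ'],
      show (0 : RatPoint A B) = P + Q by simp [hPQ'],
      show P + P = P - Q by rw [hPQ', sub_eq_add_neg]] at this
  rcases P with _ | ⟨x₁, y₁, h₁⟩
  · rw [← Affine.Point.zero_def, zero_add, zero_sub, Affine.Point.sym2x_neg_right]
    rcases Q with _ | ⟨x₂, y₂, h₂⟩
    · exact absurd rfl hPQ
    · refine ⟨1, one_ne_zero, ?_⟩
      rw [Affine.Point.sym2x_zero_some, addSubMap_shortCurve, Affine.Point.sym2x_some_some]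
      ext i
      fin_cases i <;> simp <;> ring
  rcases Q with _ | ⟨x₂, y₂, h₂⟩
  · rw [← Affine.Point.zero_def, add_zero, sub_zero]
    refine ⟨1, one_ne_zero, ?_⟩
    rw [Affine.Point.sym2x_some_zero, addSubMap_shortCurve, Affine.Point.sym2x_some_some]
    ext i
    fin_cases i <;> simp <;> ring
  have hx : x₁ ≠ x₂ := by
    rintro rfl
    rcases Affine.Point.X_eq_iff (h₁ := h₁) (h₂ := h₂) |>.1 rfl with h | h
    · exact hPQ h
    · exact hPQ' h
  have hx' := sub_ne_zero.2 hx
  have h₂' : ((shortCurve A B)⁄ℚ).toAffine.Nonsingular x₂ (-y₂) := by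
    rw [← shortCurve_negY x₂ y₂]; exact (Affine.nonsingular_neg ..).2 h₂
  have hneg : -(Affine.Point.some x₂ y₂ h₂ : RatPoint A B) = Affine.Point.some x₂ (-y₂) h₂' := by
    rw [Affine.Point.neg_some]; congr 1; exact shortCurve_negY x₂ y₂
  obtain ⟨ℓ, m, x₃, y₃, h₃, e, l₁, l₂, -, e₁, -⟩ := exists_add_some h₁ h₂ (fun h ↦ hx h.1)
  obtain ⟨ℓ', m', x₄, y₄, h₄, e', l₁', l₂', -, e₁', -⟩ := exists_add_some h₁ h₂' (fun h ↦ hx h.1)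
  rw [sub_eq_add_neg, hneg, e, e', Affine.Point.sym2x_some_some, Affine.Point.sym2x_some_some,
    addSubMap_shortCurve]
  refine ⟨(x₁ - x₂) ^ 2, pow_ne_zero 2 hx', ?_⟩
  have c₁ := shortCurve_equation.1 h₁.left
  have c₂ := shortCurve_equation.1 h₂.left
  have f₃ : (x₁ - x₂) ^ 2 * x₃ = (y₁ - y₂) ^ 2 - (x₁ + x₂) * (x₁ - x₂) ^ 2 := by
    have : y₁ - y₂ = ℓ * (x₁ - x₂) := by linear_combination l₁ - l₂
    rw [this]; linear_combination (x₁ - x₂) ^ 2 * e₁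
  have f₄ : (x₁ - x₂) ^ 2 * x₄ = (y₁ + y₂) ^ 2 - (x₁ + x₂) * (x₁ - x₂) ^ 2 := by
    have : y₁ + y₂ = ℓ' * (x₁ - x₂) := by linear_combination l₁' - l₂'
    rw [this]; linear_combination (x₁ - x₂) ^ 2 * e₁'
  ext i
  fin_cases i <;> simp
  · apply mul_left_cancel₀ (pow_ne_zero 2 hx')
    have : (x₁ - x₂) ^ 2 * ((x₁ - x₂) ^ 2 * (x₃ * x₄)) =
      ((x₁ - x₂) ^ 2 * x₃) * ((x₁ - x₂) ^ 2 * x₄) := by ring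
    rw [this, f₃, f₄]
    have : ((y₁ - y₂) ^ 2 - (x₁ + x₂) * (x₁ - x₂) ^ 2) *
        ((y₁ + y₂) ^ 2 - (x₁ + x₂) * (x₁ - x₂) ^ 2) =
        (y₁ ^ 2 - y₂ ^ 2) ^ 2 - 2 * (x₁ + x₂) * (x₁ - x₂) ^ 2 * (y₁ ^ 2 + y₂ ^ 2) +
          (x₁ + x₂) ^ 2 * (x₁ - x₂) ^ 4 := by ring
    rw [this, c₁, c₂]
    ring
  · have : (x₁ - x₂) ^ 2 * (x₃ + x₄) =
        2 * (y₁ ^ 2 + y₂ ^ 2) - 2 * (x₁ + x₂) * (x₁ - x₂) ^ 2 := by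
      linear_combination f₃ + f₄
    rw [this, c₁, c₂]
    ring
  · ring

/-- The approximate parallelogram law for the naive height. -/
lemma exists_abs_xHeight_parallelogram_le (hE : (shortCurve A B).Δ ≠ 0) :
    ∃ C, ∀ P Q : RatPoint A B,
      |xHeight (P + Q) + xHeight (P - Q) - (2 * xHeight P + 2 * xHeight Q)| ≤ C := by
  have hΔ : ((shortCurve A B)⁄ℚ).Δ ≠ 0 := by
    change ((shortCurve A B).map (algebraMap ℤ ℚ)).Δ ≠ 0
    rw [WeierstrassCurve.map_Δ]
    simpa using hE
  have : ((shortCurve A B)⁄ℚ).IsElliptic := ⟨hΔ.isUnit⟩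
  obtain ⟨C₁, hC₁⟩ := abs_logHeight_addSubMap_sub_two_mul_logHeight_le ((shortCurve A B)⁄ℚ)
  obtain ⟨C₂, hC₂⟩ := Height.abs_logHeight_sym2_sub_le ℚ
  have sym (P Q : RatPoint A B) :
      |Height.logHeight (P.sym2x Q) - (xHeight P + xHeight Q)| ≤ C₂ := by
    have eta (R : RatPoint A B) : R.xRep = ![R.xRep 0, R.xRep 1] := by
      ext i; fin_cases i <;> rfl
    have hP := P.xRep_ne_zero
    have hQ := Q.xRep_ne_zero
    rw [eta] at hP hQ
    have := hC₂ hP hQ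
    rwa [← eta, ← eta, ← xHeight_eq_logHeight_xRep, ← xHeight_eq_logHeight_xRep] at this
  refine ⟨C₁ + 3 * C₂, fun P Q ↦ ?_⟩
  obtain ⟨c, hc, e⟩ := addSubMap_sym2x P Q
  have h₁ := hC₁ (P.sym2x Q)
  rw [e, Height.logHeight_smul_eq_logHeight _ hc] at h₁
  have h₂ := sym P Q
  have h₃ := sym (P + Q) (P - Q)
  rw [abs_le] at *
  constructor <;> linarith [h₁.1, h₁.2, h₂.1, h₂.2, h₃.1, h₃.2]

end Parallelogram

/-! ### The canonical height -/

section CanonicalHeight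

variable {A B : ℤ}

/-- The sequence that defines the canonical height converges, by Tate's telescoping argument. -/
lemma tendsto_canonicalHeightSeq (hE : (shortCurve A B).Δ ≠ 0) (P : RatPoint A B) :
    Tendsto (canonicalHeightSeq P) atTop (𝓝 (canonicalHeight P)) := by
  obtain ⟨C, hC⟩ := exists_abs_xHeight_parallelogram_le hE
  refine tendsto_nhds_limUnder (cauchySeq_tendsto_of_complete ?_)
  refine cauchySeq_of_le_geometric (1 / 4) (C / 8) (by norm_num) fun k ↦ ?_
  have h := hC (2 ^ k • P) (2 ^ k • P)
  rw [sub_self, xHeight_zero, ← two_nsmul, ← mul_nsmul', ← pow_succ'] at h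
  rw [dist_comm, Real.dist_eq]
  have : canonicalHeightSeq P (k + 1) - canonicalHeightSeq P k =
      (xHeight (2 ^ (k + 1) • P) + 0 - (2 * xHeight (2 ^ k • P) + 2 * xHeight (2 ^ k • P))) *
        (1 / 8 * (1 / 4) ^ k) := by
    simp only [canonicalHeightSeq]
    rw [one_div_pow, pow_succ (4 : ℝ)]
    field_simp
    ring
  rw [this, abs_mul, abs_of_nonneg (by positivity : (0 : ℝ) ≤ 1 / 8 * (1 / 4) ^ k)]
  calc _ ≤ C * (1 / 8 * (1 / 4) ^ k) := by gcongr
    _ = _ := by ring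

lemma canonicalHeight_zero (hE : (shortCurve A B).Δ ≠ 0) :
    canonicalHeight (0 : RatPoint A B) = 0 := by
  refine tendsto_nhds_unique (tendsto_canonicalHeightSeq hE 0) ?_
  refine tendsto_const_nhds.congr fun k ↦ ?_
  simp [canonicalHeightSeq]

/-- The parallelogram law for the canonical height. -/
lemma canonicalHeight_add_add_canonicalHeight_sub (hE : (shortCurve A B).Δ ≠ 0)
    (P Q : RatPoint A B) : canonicalHeight (P + Q) + canonicalHeight (P - Q) =
      2 * canonicalHeight P + 2 * canonicalHeight Q := by
  obtain ⟨C, hC⟩ := exists_abs_xHeight_parallelogram_le hE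
  have lim := ((tendsto_canonicalHeightSeq hE (P + Q)).add
    (tendsto_canonicalHeightSeq hE (P - Q))).sub
    (((tendsto_canonicalHeightSeq hE P).const_mul 2).add
      ((tendsto_canonicalHeightSeq hE Q).const_mul 2))
  refine sub_eq_zero.1 (tendsto_nhds_unique lim ?_)
  have geom : Tendsto (fun k : ℕ ↦ C / 2 * (1 / 4 : ℝ) ^ k) atTop (𝓝 0) := by
    simpa using (tendsto_pow_atTop_nhds_zero_of_lt_one (by norm_num) (by norm_num :
      (1 / 4 : ℝ) < 1)).const_mul (C / 2)
  refine squeeze_zero_norm (fun k ↦ ?_) geom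
  have h := hC (2 ^ k • P) (2 ^ k • Q)
  rw [← nsmul_add, ← nsmul_sub] at h
  have : canonicalHeightSeq (P + Q) k + canonicalHeightSeq (P - Q) k -
      (2 * canonicalHeightSeq P k + 2 * canonicalHeightSeq Q k) =
      (xHeight (2 ^ k • (P + Q)) + xHeight (2 ^ k • (P - Q)) -
        (2 * xHeight (2 ^ k • P) + 2 * xHeight (2 ^ k • Q))) * (1 / 2 * (1 / 4) ^ k) := by
    simp only [canonicalHeightSeq]
    rw [one_div_pow]
    field_simp
  rw [Real.norm_eq_abs, this, abs_mul,
    abs_of_nonneg (by positivity : (0 : ℝ) ≤ 1 / 2 * (1 / 4) ^ k)]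
  calc _ ≤ C * (1 / 2 * (1 / 4) ^ k) := by gcongr
    _ = _ := by ring

lemma canonicalHeight_nsmul (hE : (shortCurve A B).Δ ≠ 0) (P : RatPoint A B) (n : ℕ) :
    canonicalHeight (n • P) = n ^ 2 * canonicalHeight P := by
  induction n using Nat.strong_induction_on with
  | _ n ih =>
    match n with
    | 0 => simp [canonicalHeight_zero hE]
    | 1 => simp
    | n + 2 =>
      have h := canonicalHeight_add_add_canonicalHeight_sub hE ((n + 1) • P) P
      rw [← succ_nsmul, show (n + 1) • P - P = n • P by rw [succ_nsmul, add_sub_cancel_right],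
        ih n (by lia), ih (n + 1) (by lia)] at h
      push_cast at h ⊢
      linarith

end CanonicalHeight


/-! ### Duplication with explicit constants -/

section Duplication

variable {A B : ℤ}

lemma abs_monomial_le {S N A B a d : ℤ} (hS : 1 ≤ S) (hA : |A| ≤ S) (hB : |B| ≤ S) (ha : |a| ≤ N)
    (hd : |d| ≤ N) {e f : ℕ} (i j k l : ℕ) (hij : i + j ≤ e) (hkl : k + l = f) :
    |A ^ i * B ^ j * (a ^ k * d ^ l)| ≤ S ^ e * N ^ f := by
  rw [abs_mul, abs_mul, abs_mul, abs_pow, abs_pow, abs_pow, abs_pow]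
  have hN : 0 ≤ N := (abs_nonneg a).trans ha
  calc |A| ^ i * |B| ^ j * (|a| ^ k * |d| ^ l) ≤ S ^ i * S ^ j * (N ^ k * N ^ l) := by gcongr
    _ = S ^ (i + j) * N ^ f := by rw [← pow_add, ← pow_add, hkl]
    _ ≤ S ^ e * N ^ f := by gcongr

/-- The duplication forms `F`, `G` with `x(2P) = F / G` have a resultant that divides a power of the
discriminant; the cofactors exhibit this and bound both the common divisors of `F` and `G` and the
size of `(F, G)` from below. -/
lemma duplication_forms {S N A B a d F G : ℤ} (hS : 1 ≤ S) (hA : |A| ≤ S) (hB : |B| ≤ S)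
    (ha : |a| ≤ N) (hd : |d| ≤ N)
    (hF : F = a ^ 4 - 2 * A * a ^ 2 * d ^ 2 - 8 * B * a * d ^ 3 + A ^ 2 * d ^ 4)
    (hG : G = 4 * a ^ 3 * d + 4 * A * a * d ^ 3 + 4 * B * d ^ 4) :
    |F| ≤ (4 * S) ^ 2 * N ^ 4 ∧ |G| ≤ (4 * S) ^ 2 * N ^ 4 ∧
    (∃ f₁ g₁ : ℤ, f₁ * F - g₁ * G = 4 * (4 * A ^ 3 + 27 * B ^ 2) * d ^ 7 ∧
      |f₁| + |g₁| ≤ (4 * S) ^ 5 * N ^ 3) ∧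
    ∃ f₂ g₂ : ℤ, f₂ * F + g₂ * G = 4 * (4 * A ^ 3 + 27 * B ^ 2) * a ^ 7 ∧
      |f₂| + |g₂| ≤ (4 * S) ^ 5 * N ^ 3 := by
  have q (i j k l : ℕ) (hij : i + j ≤ 2) (hkl : k + l = 4) :=
    abs_le.1 (abs_monomial_le hS hA hB ha hd i j k l hij hkl)
  have c (i j k l : ℕ) (hij : i + j ≤ 5) (hkl : k + l = 3) :=
    abs_le.1 (abs_monomial_le hS hA hB ha hd i j k l hij hkl)
  have hN : 0 ≤ N := (abs_nonneg a).trans ha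
  have p2 : 0 ≤ S ^ 2 * N ^ 4 := by positivity
  have p5 : 0 ≤ S ^ 5 * N ^ 3 := by positivity
  refine ⟨?_, ?_, ⟨12 * a ^ 2 * d + 16 * A * d ^ 3,
    3 * a ^ 3 - 5 * A * a * d ^ 2 - 27 * B * d ^ 3, ?_, ?_⟩,
    ⟨4 * (4 * A ^ 3 + 27 * B ^ 2) * a ^ 3 - 4 * A ^ 2 * B * a ^ 2 * d +
      4 * A * (3 * A ^ 3 + 22 * B ^ 2) * a * d ^ 2 + 12 * B * (A ^ 3 + 8 * B ^ 2) * d ^ 3,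
    A ^ 2 * B * a ^ 3 + A * (5 * A ^ 3 + 32 * B ^ 2) * a ^ 2 * d +
      2 * B * (13 * A ^ 3 + 96 * B ^ 2) * a * d ^ 2 - 3 * A ^ 2 * (A ^ 3 + 8 * B ^ 2) * d ^ 3,
    ?_, ?_⟩⟩
  · have h1 := q 0 0 4 0 (by norm_num) rfl
    have h2 := q 1 0 2 2 (by norm_num) rfl
    have h3 := q 0 1 1 3 (by norm_num) rfl
    have h4 := q 2 0 0 4 (by norm_num) rfl
    rw [hF, abs_le]
    constructor <;> linarith [h1.1, h1.2, h2.1, h2.2, h3.1, h3.2, h4.1, h4.2]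
  · have h1 := q 0 0 3 1 (by norm_num) rfl
    have h2 := q 1 0 1 3 (by norm_num) rfl
    have h3 := q 0 1 0 4 (by norm_num) rfl
    rw [hG, abs_le]
    constructor <;> linarith [h1.1, h1.2, h2.1, h2.2, h3.1, h3.2]
  · rw [hF, hG]; ring
  · have h1 := c 0 0 2 1 (by norm_num) rfl
    have h2 := c 1 0 0 3 (by norm_num) rfl
    have h3 := c 0 0 3 0 (by norm_num) rfl
    have h4 := c 1 0 1 2 (by norm_num) rfl
    have h5 := c 0 1 0 3 (by norm_num) rfl
    have b1 : |12 * a ^ 2 * d + 16 * A * d ^ 3| ≤ 28 * (S ^ 5 * N ^ 3) := by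
      rw [abs_le]
      constructor <;> linarith [h1.1, h1.2, h2.1, h2.2]
    have b2 : |3 * a ^ 3 - 5 * A * a * d ^ 2 - 27 * B * d ^ 3| ≤ 35 * (S ^ 5 * N ^ 3) := by
      rw [abs_le]
      constructor <;> linarith [h3.1, h3.2, h4.1, h4.2, h5.1, h5.2]
    linarith
  · rw [hF, hG]; ring
  · have h1 := c 3 0 3 0 (by norm_num) rfl
    have h2 := c 0 2 3 0 (by norm_num) rfl
    have h3 := c 2 1 2 1 (by norm_num) rfl
    have h4 := c 4 0 1 2 (by norm_num) rfl
    have h5 := c 1 2 1 2 (by norm_num) rfl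
    have h6 := c 3 1 0 3 (by norm_num) rfl
    have h7 := c 0 3 0 3 (by norm_num) rfl
    have k1 := c 2 1 3 0 (by norm_num) rfl
    have k2 := c 4 0 2 1 (by norm_num) rfl
    have k3 := c 1 2 2 1 (by norm_num) rfl
    have k4 := c 3 1 1 2 (by norm_num) rfl
    have k5 := c 0 3 1 2 (by norm_num) rfl
    have k6 := c 5 0 0 3 (by norm_num) rfl
    have k7 := c 2 2 0 3 (by norm_num) rfl
    have b1 : |4 * (4 * A ^ 3 + 27 * B ^ 2) * a ^ 3 - 4 * A ^ 2 * B * a ^ 2 * d +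
        4 * A * (3 * A ^ 3 + 22 * B ^ 2) * a * d ^ 2 + 12 * B * (A ^ 3 + 8 * B ^ 2) * d ^ 3| ≤
        336 * (S ^ 5 * N ^ 3) := by
      rw [abs_le]
      constructor <;> linarith [h1.1, h1.2, h2.1, h2.2, h3.1, h3.2, h4.1, h4.2, h5.1, h5.2,
        h6.1, h6.2, h7.1, h7.2]
    have b2 : |A ^ 2 * B * a ^ 3 + A * (5 * A ^ 3 + 32 * B ^ 2) * a ^ 2 * d +
        2 * B * (13 * A ^ 3 + 96 * B ^ 2) * a * d ^ 2 - 3 * A ^ 2 * (A ^ 3 + 8 * B ^ 2) * d ^ 3| ≤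
        283 * (S ^ 5 * N ^ 3) := by
      rw [abs_le]
      constructor <;> linarith [k1.1, k1.2, k2.1, k2.2, k3.1, k3.2, k4.1, k4.2, k5.1, k5.2,
        k6.1, k6.2, k7.1, k7.2]
    linarith

/-- The change of the naive height of a rational number under the duplication map, with explicit
constants. -/
lemma duplication_height_bounds {S A B : ℤ} (hS : 1 ≤ S) (hA : |A| ≤ S) (hB : |B| ≤ S)
    (hD : 4 * A ^ 3 + 27 * B ^ 2 ≠ 0) {x x₃ : ℚ} (hx : x ^ 3 + A * x + B ≠ 0)
    (hx₃ : 4 * (x ^ 3 + A * x + B) * x₃ = x ^ 4 - 2 * A * x ^ 2 - 8 * B * x + A ^ 2) :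
    max |x₃.num| x₃.den ≤ (4 * S) ^ 2 * max |x.num| x.den ^ 4 ∧
    max |x.num| x.den ^ 4 ≤ (4 * S) ^ 5 * max |x₃.num| x₃.den := by
  obtain ⟨a, ha⟩ : ∃ a, a = x.num := ⟨_, rfl⟩
  obtain ⟨d, hd⟩ : ∃ d : ℤ, d = x.den := ⟨_, rfl⟩
  have hd0 : 0 < d := by rw [hd]; exact_mod_cast x.pos
  have hdQ : (d : ℚ) ≠ 0 := by exact_mod_cast hd0.ne'
  have hxad : x = a / d := by
    rw [ha, hd]; exact_mod_cast (Rat.num_div_den x).symm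
  have hcop : IsCoprime a d := by
    rw [ha, hd]; exact Rat.isCoprime_num_den x
  rw [← ha, ← hd]
  obtain ⟨N, hN⟩ : ∃ N, N = max |a| d := ⟨_, rfl⟩
  have haN : |a| ≤ N := hN ▸ le_max_left _ _
  have hdN : |d| ≤ N := by rw [abs_of_pos hd0]; exact hN ▸ le_max_right _ _
  have hN1 : 0 < N := hd0.trans_le (hN ▸ le_max_right _ _)
  rw [← hN]
  obtain ⟨F, hF⟩ : ∃ F, F = a ^ 4 - 2 * A * a ^ 2 * d ^ 2 - 8 * B * a * d ^ 3 + A ^ 2 * d ^ 4 :=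
    ⟨_, rfl⟩
  obtain ⟨G, hG⟩ : ∃ G, G = 4 * a ^ 3 * d + 4 * A * a * d ^ 3 + 4 * B * d ^ 4 := ⟨_, rfl⟩
  obtain ⟨uF, uG, ⟨f₁, g₁, i₁, b₁⟩, ⟨f₂, g₂, i₂, b₂⟩⟩ :=
    duplication_forms hS hA hB haN hdN hF hG
  have hGx : (G : ℚ) = 4 * (x ^ 3 + A * x + B) * d ^ 4 := by
    rw [hG, hxad]; push_cast; field_simp
  have hFx : (F : ℚ) = (x ^ 4 - 2 * A * x ^ 2 - 8 * B * x + A ^ 2) * d ^ 4 := by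
    rw [hF, hxad]; push_cast; field_simp
  have hG0 : G ≠ 0 := by
    have : (G : ℚ) ≠ 0 := by
      rw [hGx]; exact mul_ne_zero (mul_ne_zero four_ne_zero hx) (pow_ne_zero 4 hdQ)
    exact_mod_cast this
  have hx₃' : x₃ = F / G := by
    rw [eq_div_iff (by exact_mod_cast hG0), hGx, hFx, ← hx₃]; ring
  obtain ⟨g, hgF, hgG⟩ := Rat.exists_eq_mul_div_num_and_eq_mul_div_den F hG0
  rw [← hx₃'] at hgF hgG
  obtain ⟨m, hm⟩ : ∃ m : ℤ, m = max |x₃.num| x₃.den := ⟨_, rfl⟩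
  have hm0 : 0 ≤ m := by rw [hm]; positivity
  have hg0 : g ≠ 0 := by rintro rfl; rw [zero_mul] at hgG; exact hG0 hgG
  have hg1 : 1 ≤ |g| := Int.one_le_abs hg0
  have hFm : |F| ≤ |g| * m := by
    rw [hgF, abs_mul, hm]; gcongr; exact le_max_left _ _
  have hGm : |G| ≤ |g| * m := by
    rw [hgG, abs_mul, hm]
    gcongr
    rw [Nat.abs_cast]
    exact le_max_right _ _
  rw [← hm]
  constructor
  · rw [hm]
    refine max_le ?_ ?_
    · refine le_trans ?_ uF
      rw [hgF, abs_mul]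
      exact le_mul_of_one_le_left (abs_nonneg _) hg1
    · refine le_trans ?_ uG
      rw [hgG, abs_mul, Nat.abs_cast]
      exact le_mul_of_one_le_left (Int.natCast_nonneg _) hg1
  · obtain ⟨D, hDD⟩ : ∃ D, D = 4 * (4 * A ^ 3 + 27 * B ^ 2) := ⟨_, rfl⟩
    have hD0 : 0 < |D| := by rw [hDD, abs_pos]; exact mul_ne_zero four_ne_zero hD
    rw [← hDD] at i₁ i₂
    -- the common factor `g` cancelled from `F / G` divides `D`
    have hgD : |g| ≤ |D| := by
      have d1 : g ∣ D * d ^ 7 := by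
        rw [← i₁]
        exact dvd_sub (Dvd.dvd.mul_left ⟨_, hgF⟩ _) (Dvd.dvd.mul_left ⟨_, hgG⟩ _)
      have d2 : g ∣ D * a ^ 7 := by
        rw [← i₂]
        exact dvd_add (Dvd.dvd.mul_left ⟨_, hgF⟩ _) (Dvd.dvd.mul_left ⟨_, hgG⟩ _)
      obtain ⟨r, s, hrs⟩ := hcop.pow (m := 7) (n := 7)
      have : g ∣ D := by
        have := dvd_add (d2.mul_left r) (d1.mul_left s)
        rwa [show r * (D * a ^ 7) + s * (D * d ^ 7) = D * (r * a ^ 7 + s * d ^ 7) by ring, hrs,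
          mul_one] at this
      exact Int.le_of_dvd hD0 ((abs_dvd_abs _ _).2 this)
    have size {f g' : ℤ} (hb : |f| + |g'| ≤ (4 * S) ^ 5 * N ^ 3) :
        |f * F| + |g' * G| ≤ (4 * S) ^ 5 * N ^ 3 * (|D| * m) := by
      rw [abs_mul, abs_mul]
      have h1 : |F| ≤ |D| * m := hFm.trans (by gcongr)
      have h2 : |G| ≤ |D| * m := hGm.trans (by gcongr)
      calc |f| * |F| + |g'| * |G| ≤ |f| * (|D| * m) + |g'| * (|D| * m) := by gcongr
        _ = (|f| + |g'|) * (|D| * m) := by ring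
        _ ≤ _ := by gcongr
    have hpow : |D| * N ^ 7 ≤ (4 * S) ^ 5 * N ^ 3 * (|D| * m) := by
      rcases le_total |a| d with had | had
      · have e : N = d := by rw [hN, max_eq_right had]
        refine le_trans (le_of_eq ?_) ((abs_sub _ _).trans (size b₁))
        rw [i₁, abs_mul, abs_pow, abs_of_pos hd0, e]
      · have e : N = |a| := by rw [hN, max_eq_left had]
        refine le_trans (le_of_eq ?_) ((abs_add_le _ _).trans (size b₂))
        rw [i₂, abs_mul, abs_pow, e]
    have : (|D| * N ^ 3) * N ^ 4 ≤ (|D| * N ^ 3) * ((4 * S) ^ 5 * m) := by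
      refine le_trans (le_of_eq ?_) (hpow.trans (le_of_eq ?_)) <;> ring
    exact le_of_mul_le_mul_left this (by positivity)

end Duplication


/-! ### Comparison of the canonical and the naive height -/

section HeightComparison

variable {A B : ℤ}

lemma shortCurve_Δ (A B : ℤ) : (shortCurve A B).Δ = -16 * (4 * A ^ 3 + 27 * B ^ 2) := by
  simp [shortCurve, WeierstrassCurve.Δ, WeierstrassCurve.b₂, WeierstrassCurve.b₄,
    WeierstrassCurve.b₆, WeierstrassCurve.b₈]
  ring

lemma one_le_max_abs (hE : (shortCurve A B).Δ ≠ 0) : 1 ≤ max |A| |B| := by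
  by_contra! h
  obtain ⟨hA, hB⟩ := max_lt_iff.1 h
  rw [Int.abs_lt_one_iff] at hA hB
  exact hE (by simp [shortCurve_Δ, hA, hB])

lemma xHeight_some {x y : ℚ} (h : ((shortCurve A B)⁄ℚ).toAffine.Nonsingular x y) :
    xHeight (Affine.Point.some x y h : RatPoint A B) =
      Real.log ((max |x.num| x.den : ℤ) : ℝ) := by
  change Height.logHeight₁ x = _
  rw [Rat.logHeight₁_eq_log_max, ← Int.natCast_natAbs]
  norm_cast

/-- The effect of doubling a point of infinite order on the naive height. -/
lemma xHeight_two_nsmul_bounds (hE : (shortCurve A B).Δ ≠ 0) {P : RatPoint A B}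
    (hP : ¬IsOfFinAddOrder P) :
    xHeight (2 • P) ≤ 4 * xHeight P + 2 * Real.log (4 * max |A| |B| : ℤ) ∧
    4 * xHeight P ≤ xHeight (2 • P) + 5 * Real.log (4 * max |A| |B| : ℤ) := by
  have hS := one_le_max_abs hE
  have hD : 4 * A ^ 3 + 27 * B ^ 2 ≠ 0 := by
    intro h0; apply hE; rw [shortCurve_Δ, h0, mul_zero]
  rcases P with _ | ⟨x, y, h⟩
  · exact absurd IsOfFinAddOrder.zero hP
  have hy : y ≠ 0 := by
    rintro rfl
    refine hP (isOfFinAddOrder_iff_nsmul_eq_zero.2 ⟨2, two_pos, ?_⟩)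
    rw [two_nsmul]
    exact Affine.Point.add_of_Y_eq rfl (by rw [shortCurve_negY, neg_zero])
  obtain ⟨ℓ, m, x₃, y₃, h₃, e, -, -, -, e₁, -, -, ht⟩ := exists_add_some h h
    (by rintro ⟨-, h0⟩; exact hy (by linarith))
  have ht := (ht rfl).2
  have c := shortCurve_equation.1 h.left
  have hx₃ : 4 * (x ^ 3 + A * x + B) * x₃ = x ^ 4 - 2 * A * x ^ 2 - 8 * B * x + A ^ 2 := by
    rw [← c, show x₃ = ℓ ^ 2 - 2 * x by linear_combination e₁]
    linear_combination (2 * y * ℓ + 3 * x ^ 2 + A) * ht - 8 * x * c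
  obtain ⟨hu, hl⟩ := duplication_height_bounds hS (le_max_left _ _) (le_max_right _ _) hD
    (c ▸ pow_ne_zero 2 hy) hx₃
  rw [two_nsmul, e, xHeight_some, xHeight_some]
  have hd (q : ℚ) : (0 : ℝ) < (max |q.num| q.den : ℤ) := by
    exact_mod_cast lt_of_lt_of_le (Int.natCast_pos.2 q.pos) (le_max_right _ _)
  have hS' : (0 : ℝ) < (4 * max |A| |B| : ℤ) := by exact_mod_cast (by lia)
  have hd₁ := hd x
  have hd₃ := hd x₃
  generalize max |x.num| (x.den : ℤ) = N at *
  generalize max |x₃.num| (x₃.den : ℤ) = m at *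
  generalize 4 * max |A| |B| = T at *
  have l4 : Real.log ((N : ℝ) ^ 4) = 4 * Real.log N := by rw [Real.log_pow]; norm_num
  constructor
  · have : (m : ℝ) ≤ T ^ 2 * N ^ 4 := by exact_mod_cast hu
    have := Real.log_le_log hd₃ this
    rw [Real.log_mul (by positivity) (by positivity), l4, Real.log_pow] at this
    push_cast at this
    linarith
  · have : (N : ℝ) ^ 4 ≤ T ^ 5 * m := by exact_mod_cast hl
    have := Real.log_le_log (by positivity) this
    rw [Real.log_mul (by positivity) (by positivity), l4, Real.log_pow] at this
    push_cast at this
    linarith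

/-- An explicit comparison between the canonical and the naive height. -/
lemma canonicalHeight_bounds (hE : (shortCurve A B).Δ ≠ 0) {P : RatPoint A B}
    (hP : ¬IsOfFinAddOrder P) :
    canonicalHeight P ≤ 1 / 2 * xHeight P + 1 / 3 * Real.log (4 * max |A| |B| : ℤ) ∧
    1 / 2 * xHeight P - 5 / 6 * Real.log (4 * max |A| |B| : ℤ) ≤ canonicalHeight P := by
  have hH : 0 ≤ Real.log (4 * max |A| |B| : ℤ) := by
    refine Real.log_nonneg ?_
    have := one_le_max_abs hE
    exact_mod_cast (by lia)
  generalize hHdef : Real.log (4 * max |A| |B| : ℤ) = H at *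
  have step (k : ℕ) : xHeight (2 ^ (k + 1) • P) ≤ 4 * xHeight (2 ^ k • P) + 2 * H ∧
      4 * xHeight (2 ^ k • P) ≤ xHeight (2 ^ (k + 1) • P) + 5 * H := by
    have hk : ¬IsOfFinAddOrder (2 ^ k • P) := by
      rw [isOfFinAddOrder_nsmul]
      exact not_or.2 ⟨hP, by positivity⟩
    have := xHeight_two_nsmul_bounds hE hk
    rwa [← mul_nsmul', ← pow_succ', hHdef] at this
  have iter (k : ℕ) : xHeight (2 ^ k • P) ≤ 4 ^ k * xHeight P + (4 ^ k - 1) / 3 * (2 * H) ∧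
      4 ^ k * xHeight P ≤ xHeight (2 ^ k • P) + (4 ^ k - 1) / 3 * (5 * H) := by
    induction k with
    | zero => simp
    | succ k ih =>
      obtain ⟨s₁, s₂⟩ := step k
      obtain ⟨i₁, i₂⟩ := ih
      rw [pow_succ (4 : ℝ)]
      constructor <;> linarith
  have lim := tendsto_canonicalHeightSeq hE P
  constructor
  · refine le_of_tendsto' lim fun k ↦ ?_
    rw [canonicalHeightSeq, ← mul_div_assoc, div_le_iff₀ (by positivity)]
    linarith [(iter k).1]
  · refine ge_of_tendsto' lim fun k ↦ ?_
    rw [canonicalHeightSeq, ← mul_div_assoc, le_div_iff₀ (by positivity)]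
    linarith [(iter k).2]

end HeightComparison

/-! ### Points with an integral multiple -/

section Bound

variable {A B : ℤ}

lemma xHeight_some_intCast {b : ℤ} {y : ℚ}
    (h : ((shortCurve A B)⁄ℚ).toAffine.Nonsingular (b : ℚ) y) :
    xHeight (Affine.Point.some (b : ℚ) y h : RatPoint A B) = Real.log ((max |b| 1 : ℤ) : ℝ) := by
  rw [xHeight_some]; simp

/-- The `x`-coordinates of integral points are bounded from below. -/
lemma neg_le_of_equation {S A B b : ℤ} {y : ℚ} (hS : 1 ≤ S) (hA : |A| ≤ S) (hB : |B| ≤ S)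
    (h : y ^ 2 = (b : ℚ) ^ 3 + A * b + B) : -(4 * S) ≤ b := by
  by_contra! hb
  have h0 : 0 ≤ b ^ 3 + A * b + B := by
    have : (0 : ℚ) ≤ (b : ℚ) ^ 3 + A * b + B := h ▸ sq_nonneg y
    exact_mod_cast this
  obtain ⟨c, rfl⟩ : ∃ c, b = -c := ⟨-b, (neg_neg b).symm⟩
  have hc : 4 * S < c := by lia
  have h1 : -A * c ≤ S * c :=
    mul_le_mul_of_nonneg_right (neg_le.1 (neg_le_of_abs_le hA)) (by lia)
  have h2 : S * c ≤ c * c := mul_le_mul_of_nonneg_right (by lia) (by lia)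
  have h3 : 4 * (c * c) ≤ c * (c * c) := mul_le_mul_of_nonneg_right (by lia) (mul_self_nonneg c)
  have h4 : 1 * c ≤ c * c := mul_le_mul_of_nonneg_right (by lia) (by lia)
  have := le_of_abs_le hB
  linarith

/-- If `nP` is integral then `ĥ(P) ≤ log n + 2 log max {4|A|, 4|B|}`. -/
lemma canonicalHeight_le_log_add (hE : (shortCurve A B).Δ ≠ 0) {P : RatPoint A B}
    (hP : ¬IsOfFinAddOrder P) {n : ℕ} (hn : 2 ≤ n) (hint : IsIntegralPoint (n • P)) :
    canonicalHeight P ≤ Real.log n + 2 * Real.log (4 * max |A| |B| : ℤ) := by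
  have hS := one_le_max_abs hE
  obtain ⟨hup, hlow⟩ := canonicalHeight_bounds hE hP
  obtain ⟨T, hT⟩ : ∃ T, T = 4 * max |A| |B| := ⟨_, rfl⟩
  have hT4 : 4 ≤ T := by lia
  have hAT : |(A : ℚ)| ≤ T / 4 := by
    have : 4 * |A| ≤ T := by lia
    have : (4 : ℚ) * |(A : ℚ)| ≤ T := by exact_mod_cast this
    linarith
  have hBT : |(B : ℚ)| ≤ T / 4 := by
    have : 4 * |B| ≤ T := by lia
    have : (4 : ℚ) * |(B : ℚ)| ≤ T := by exact_mod_cast this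
    linarith
  have hT4' : (4 : ℝ) ≤ T := by exact_mod_cast hT4
  have hn' : (2 : ℝ) ≤ n := by exact_mod_cast hn
  have hlog4 : Real.log 4 ≤ Real.log T := Real.log_le_log (by norm_num) hT4'
  have hlog0 : 0 < Real.log T := Real.log_pos (by linarith)
  rcases hPxy : P with _ | ⟨x, y, h⟩
  · exact absurd (hPxy ▸ IsOfFinAddOrder.zero) hP
  rcases hnP : n • P with _ | ⟨x', y', h'⟩
  · rw [hnP] at hint; exact hint.elim
  rw [hnP] at hint
  obtain ⟨a, -, rfl, -⟩ := hint
  obtain ⟨b, rfl⟩ := exists_int_x_of_nsmul hP (by lia) hPxy hnP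
  have c := shortCurve_equation.1 h.left
  have hb : -(4 * max |A| |B|) ≤ b := neg_le_of_equation hS (le_max_left _ _) (le_max_right _ _) c
  have hxP := xHeight_some_intCast h
  rw [← hPxy] at hxP ⊢
  rw [← hT] at hup hlow hb ⊢
  have hn1 : 1 ≤ (n : ℤ) ^ 2 := by exact_mod_cast Nat.one_le_pow _ _ (by lia)
  have hTT : 4 * T ≤ T ^ 2 := by rw [sq]; gcongr
  rcases le_or_gt b (4 * n ^ 2 * T ^ 2) with hsmall | hlarge
  · -- `x(P)` is at most of the order of `n²`, and `ĥ(P) ≤ (log 4 + 2 log n + 2 H) / 2 + H / 3`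
    have hmax : max |b| 1 ≤ 4 * n ^ 2 * T ^ 2 := by
      have : 1 * T ^ 2 ≤ 4 * (n : ℤ) ^ 2 * T ^ 2 := by gcongr; lia
      refine max_le (abs_le.2 ⟨by lia, hsmall⟩) (by lia)
    have hmax' : ((max |b| 1 : ℤ) : ℝ) ≤ 4 * n ^ 2 * T ^ 2 := by exact_mod_cast hmax
    have hpos : (0 : ℝ) < (max |b| 1 : ℤ) := by
      exact_mod_cast lt_of_lt_of_le one_pos (le_max_right _ _)
    have := Real.log_le_log hpos hmax'
    rw [Real.log_mul (by positivity) (by positivity), Real.log_mul (by positivity) (by positivity),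
      Real.log_pow, Real.log_pow, ← hxP] at this
    push_cast at this
    linarith
  · -- otherwise the height of `nP` is not much larger than the height of `P`
    have hb1 : 1 ≤ b := by nlinarith
    have hy : y ≠ 0 := by
      rintro rfl
      refine hP (isOfFinAddOrder_iff_nsmul_eq_zero.2 ⟨2, two_pos, ?_⟩)
      rw [two_nsmul, hPxy]
      exact Affine.Point.add_of_Y_eq rfl (by rw [shortCurve_negY, neg_zero])
    have hlargeQ : 4 * (n : ℚ) ^ 2 * T ^ 2 ≤ b := by exact_mod_cast hlarge.le
    have hT4Q : (4 : ℚ) ≤ T := by exact_mod_cast hT4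
    have ha : 0 < a ∧ a ≤ 4 * b := by
      have concl {x'' : ℚ} (e : x'' = a) (h0 : 0 < x'') (h4 : x'' ≤ 4 * b) :
          0 < a ∧ a ≤ 4 * b := by
        rw [e] at h0 h4
        exact ⟨by exact_mod_cast h0, by exact_mod_cast h4⟩
      rcases lt_or_gt_of_ne hy with hneg | hpos
      · have hneg' : -P = Affine.Point.some (b : ℚ) _ ((Affine.nonsingular_neg ..).2 h) := by
          rw [hPxy, Affine.Point.neg_some]
        obtain ⟨x'', y'', h'', e, h0, h4⟩ := x_nsmul_le_of_large_x hT4Q hAT hBT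
          ((Affine.nonsingular_neg ..).2 h) (by rw [shortCurve_negY]; linarith) hn hlargeQ
        rw [← hneg', neg_nsmul, hnP, Affine.Point.neg_some] at e
        exact concl ((Affine.Point.some.injEq ..).mp e).1.symm h0 h4
      · obtain ⟨x'', y'', h'', e, h0, h4⟩ := x_nsmul_le_of_large_x hT4Q hAT hBT h hpos hn hlargeQ
        rw [← hPxy, hnP] at e
        exact concl ((Affine.Point.some.injEq ..).mp e).1.symm h0 h4
    have hxn := xHeight_some_intCast h'
    rw [← hnP, abs_of_pos ha.1, max_eq_left (by lia)] at hxn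
    rw [abs_of_pos (by lia), max_eq_left hb1] at hxP
    have hnh : xHeight (n • P) ≤ xHeight P + Real.log T := by
      have : (a : ℝ) ≤ 4 * b := by exact_mod_cast ha.2
      have hb0 : (0 : ℝ) < b := by exact_mod_cast hb1
      have := Real.log_le_log (by exact_mod_cast ha.1) this
      rw [Real.log_mul (by norm_num) hb0.ne'] at this
      rw [hxn, hxP]
      linarith
    have hnP' : ¬IsOfFinAddOrder (n • P) := by
      rw [isOfFinAddOrder_nsmul]
      exact not_or.2 ⟨hP, by lia⟩
    have hupn := (canonicalHeight_bounds hE hnP').1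
    rw [canonicalHeight_nsmul hE, ← hT] at hupn
    have hlogn : 0 < Real.log n := Real.log_pos (by linarith)
    -- `(n² - 1) ĥ(P)` is bounded, and `n² - 1 ≥ 3`
    by_contra! hcon
    have : (4 : ℝ) ≤ n ^ 2 := by nlinarith
    have := mul_le_mul_of_nonneg_right this (by linarith : 0 ≤ canonicalHeight P)
    linarith

end Bound

end QuasiMinimal

theorem mainTheorem8 (A B : ℤ) (hE : (QuasiMinimal.shortCurve A B).Δ ≠ 0)
    (hmin : QuasiMinimal.IsQuasiMinimal A B)
    (P : QuasiMinimal.RatPoint A B) (hP : ¬ IsOfFinAddOrder P)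
    (n : ℕ) (hn : 2 ≤ n) (hint : QuasiMinimal.IsIntegralPoint (n • P)) :
    Tendsto (QuasiMinimal.canonicalHeightSeq P) atTop (𝓝 (QuasiMinimal.canonicalHeight P)) ∧
    QuasiMinimal.canonicalHeight P ≤
      Real.log n + (16 / 3 * (QuasiMinimal.componentLcm P : ℝ) ^ 2 + 2) *
        QuasiMinimal.curveHeight A B := by
  refine ⟨QuasiMinimal.tendsto_canonicalHeightSeq hE P, ?_⟩
  have hS := QuasiMinimal.one_le_max_abs hE
  have hle : Real.log (4 * max |A| |B| : ℤ) ≤ QuasiMinimal.curveHeight A B := by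
    refine le_trans (le_of_eq ?_) (le_max_right _ _)
    rw [← mul_max_of_nonneg _ _ (by norm_num : (0 : ℝ) ≤ 4)]
    push_cast
    rfl
  have h0 : 0 ≤ Real.log (4 * max |A| |B| : ℤ) :=
    Real.log_nonneg (by exact_mod_cast (by lia : 1 ≤ 4 * max |A| |B|))
  refine (QuasiMinimal.canonicalHeight_le_log_add hE hP hn hint).trans ?_
  have : 0 ≤ 16 / 3 * (QuasiMinimal.componentLcm P : ℝ) ^ 2 * QuasiMinimal.curveHeight A B :=
    mul_nonneg (by positivity) (h0.trans hle)
  linarith
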